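/- \textbf{Theorem (Algebraic Hilton--Milnor).} A \emph{Lie algebra} (over $\mathbb{Z}$) is an abelian group $\mathfrak g$ with a biadditive operation $[-,-]$ such that $[u,v]=-[v,u]$ and $[u,[v,w]]+[w,[u,v]]+[v,[w,u]]=0$ for all $u,v,w\in\mathfrak g$ (it is not required that $[u,u]=0$). For an abelian group $V$, let $\mathrm{Lie}[V]$ be the free Lie algebra generated by $V$. A nonempty word in letters $c_1<\dots<c_k$ is a \emph{Lyndon word} if it is strictly smaller, in the lexicographic order, than all of its nontrivial cyclic rotations. Write $B(m_1,\dots,m_k)$ for the set of Lyndon words which involve each $c_i$ precisely $m_i$ times. Every Lyndon word $w$ of length at least $2$ has a \emph{standard factorisation} $w=uv$, with $u<v$ both Lyndon words and $u$ as long as possible. Define parenthesised monomials recursively: $\phi(c_i)=c_i$ and $\phi(w)=[\phi(u),\phi(v)]$ if $w=uv$ is the standard factorisation. Let $V_1,\dots,V_k$ be free abelian groups. For $u\in B(m_1,\dots,m_k)$, let $\tilde u$ be the multilinear monomial obtained from $\phi(u)$ by replacing, for all $i$ and $j$, the $j$-th occurrence from the left of $c_i$ by the letter $c_{i,j}$.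 Let $$\beta_u\colon V_1^{\otimes m_1}\otimes\cdots\otimes V_k^{\otimes m_k}\longrightarrow \mathrm{Lie}[V_1\oplus\cdots\oplus V_k]$$ be the homomorphism of abelian groups which sends $\bigotimes_{i=1}^k\bigotimes_{j=1}^{m_i}v_i^j$ (with $v_i^j\in V_i$) to the value of $\tilde u$ obtained by substituting $v_i^j$ for $c_{i,j}$, and let $\tilde\beta_u\colon \mathrm{Lie}[V_1^{\otimes m_1}\otimes\cdots\otimes V_k^{\otimes m_k}]\to\mathrm{Lie}[V_1\oplus\cdots\oplus V_k]$ be its unique extension to a homomorphism of Lie algebras. Then the homomorphism of abelian groups $$\bigoplus\tilde\beta_u\colon \bigoplus_{\substack{m_1,\dots,m_k\ge 0\\ u\in B(m_1,\dots,m_k)}}\mathrm{Lie}[V_1^{\otimes m_1}\otimes\cdots\otimes V_k^{\otimes m_k}]\longrightarrow \mathrm{Lie}[V_1\oplus\cdots\oplus V_k]$$ given by the direct sum of all the maps $\tilde\beta_u$ is an isomorphism. -/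

import Mathlib

namespace HiltonMilnor

open scoped DirectSum TensorProduct

/-! ### Lie algebras over the integers, in the antisymmetric (non-isotropic) sense -/

/-- A Lie algebra over `ℤ`: an abelian group with a biadditive bracket which is antisymmetric and
satisfies the Jacobi identity. It is not required that `⁅u, u⁆ = 0`. -/
class AntisymLieRing (L : Type*) extends AddCommGroup L, Bracket L L where
  add_lie : ∀ u v w : L, ⁅u + v, w⁆ = ⁅u, w⁆ + ⁅v, w⁆
  lie_add : ∀ u v w : L, ⁅u, v + w⁆ = ⁅u, v⁆ + ⁅u, w⁆
  lie_skew : ∀ u v : L, ⁅u, v⁆ = -⁅v, u⁆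
  jacobi : ∀ u v w : L, ⁅u, ⁅v, w⁆⁆ + ⁅w, ⁅u, v⁆⁆ + ⁅v, ⁅w, u⁆⁆ = 0

/-- Homomorphisms of Lie algebras over `ℤ`. -/
structure AntisymLieHom (L M : Type*) [AntisymLieRing L] [AntisymLieRing M] extends L →+ M where
  map_lie' : ∀ u v : L, toFun ⁅u, v⁆ = ⁅toFun u, toFun v⁆

/-- The relations defining the free Lie algebra on the abelian group `V`, as a quotient of the free
non-associative non-unital ring on the underlying set of `V`: additivity of the inclusion of
generators, antisymmetry and the Jacobi relation. -/
inductive FreeLie.Rel (V : Type*) [AddCommGroup V] :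
    FreeNonUnitalNonAssocAlgebra ℤ V → FreeNonUnitalNonAssocAlgebra ℤ V → Prop
  | of_add (v w : V) : FreeLie.Rel V (FreeNonUnitalNonAssocAlgebra.of ℤ (v + w))
      (FreeNonUnitalNonAssocAlgebra.of ℤ v + FreeNonUnitalNonAssocAlgebra.of ℤ w)
  | skew (a b : FreeNonUnitalNonAssocAlgebra ℤ V) : FreeLie.Rel V (a * b) (-(b * a))
  | jacobi (a b c : FreeNonUnitalNonAssocAlgebra ℤ V) :
      FreeLie.Rel V (a * (b * c) + c * (a * b) + b * (c * a)) 0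

/-- The free Lie algebra `Lie[V]` generated by an abelian group `V`: the quotient of the free
non-associative non-unital ring by the two-sided congruence generated by the relations. -/
def FreeLie (V : Type*) [AddCommGroup V] : Type _ := (ringConGen (FreeLie.Rel V)).Quotient

namespace FreeLie

section

variable (V : Type*) [AddCommGroup V]

noncomputable instance instRing : NonUnitalNonAssocRing (FreeLie V) :=
  inferInstanceAs (NonUnitalNonAssocRing (ringConGen (FreeLie.Rel V)).Quotient)

/-- The quotient map. -/
noncomputable def mk (a : FreeNonUnitalNonAssocAlgebra ℤ V) : FreeLie V :=
  RingCon.toQuotient (c := ringConGen (FreeLie.Rel V)) a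

theorem mk_surjective : Function.Surjective (mk V) := Quot.mk_surjective

variable {V} in
theorem mk_eq_of_rel {a b : FreeNonUnitalNonAssocAlgebra ℤ V} (h : FreeLie.Rel V a b) :
    mk V a = mk V b :=
  Quotient.sound (RingConGen.Rel.of _ _ h)

/-- The Lie algebra structure on `Lie[V]`; the bracket is induced by the product. -/
noncomputable instance : AntisymLieRing (FreeLie V) where
  toAddCommGroup := (instRing V).toAddCommGroup
  bracket x y := x * y
  add_lie u v w := add_mul u v w
  lie_add u v w := mul_add u v w
  lie_skew u v := by
    obtain ⟨a, rfl⟩ := mk_surjective V u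
    obtain ⟨b, rfl⟩ := mk_surjective V v
    exact mk_eq_of_rel (Rel.skew a b)
  jacobi u v w := by
    obtain ⟨a, rfl⟩ := mk_surjective V u
    obtain ⟨b, rfl⟩ := mk_surjective V v
    obtain ⟨c, rfl⟩ := mk_surjective V w
    exact mk_eq_of_rel (Rel.jacobi a b c)

/-- The inclusion of generators `V → Lie[V]`. -/
noncomputable def of : V →+ FreeLie V :=
  AddMonoidHom.mk' (fun v => mk V (FreeNonUnitalNonAssocAlgebra.of ℤ v))
    fun v w => mk_eq_of_rel (Rel.of_add v w)

end

section

variable {V : Type*} [AddCommGroup V] {L : Type*} [AntisymLieRing L]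

/-- A type synonym of `L`, carrying the bracket as a multiplication. -/
def BracketRing (L : Type*) : Type _ := L

instance : NonUnitalNonAssocRing (BracketRing L) :=
  { (inferInstanceAs (AddCommGroup L) : AddCommGroup (BracketRing L)) with
    mul := Bracket.bracket (L := L) (M := L)
    left_distrib := fun x y z => AntisymLieRing.lie_add (L := L) x y z
    right_distrib := fun x y z => AntisymLieRing.add_lie (L := L) x y z
    zero_mul := fun x => by
      have h := AntisymLieRing.add_lie (L := L) 0 0 x
      rw [add_zero] at h
      exact (left_eq_add (M := L)).mp h
    mul_zero := fun x => by
      have h := AntisymLieRing.lie_add (L := L) x 0 0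
      rw [add_zero] at h
      exact (left_eq_add (M := L)).mp h }

/-- Auxiliary: the extension of `f` to the free non-associative ring. -/
noncomputable def liftAux (f : V →+ L) : FreeNonUnitalNonAssocAlgebra ℤ V →ₙₐ[ℤ] BracketRing L :=
  FreeNonUnitalNonAssocAlgebra.lift ℤ (A := BracketRing L) f

theorem liftAux_of (f : V →+ L) (v : V) :
    liftAux f (FreeNonUnitalNonAssocAlgebra.of ℤ v) = f v :=
  FreeNonUnitalNonAssocAlgebra.lift_of_apply ℤ (A := BracketRing L) (f : V → L) v

theorem liftAux_rel (f : V →+ L) {a b : FreeNonUnitalNonAssocAlgebra ℤ V}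
    (h : ringConGen (FreeLie.Rel V) a b) : liftAux f a = liftAux f b := by
  induction h with
  | of a b h =>
    cases h with
    | of_add v w => rw [map_add, liftAux_of, liftAux_of, liftAux_of]; exact map_add f v w
    | skew a b => rw [map_neg, map_mul, map_mul]; exact AntisymLieRing.lie_skew (L := L) _ _
    | jacobi a b c =>
      simp only [map_add, map_mul, map_zero]; exact AntisymLieRing.jacobi (L := L) _ _ _
  | refl a => rfl
  | symm _ ih => exact ih.symm
  | trans _ _ ih₁ ih₂ => exact ih₁.trans ih₂
  | add _ _ ih₁ ih₂ => rw [map_add, map_add, ih₁, ih₂]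
  | mul _ _ ih₁ ih₂ => rw [map_mul, map_mul, ih₁, ih₂]

/-- The unique homomorphism of Lie algebras `Lie[V] → L` extending a homomorphism of abelian groups
`V → L`. -/
noncomputable def lift (f : V →+ L) : AntisymLieHom (FreeLie V) L where
  toFun x := Quotient.lift (s := (ringConGen (FreeLie.Rel V)).toSetoid) (fun a => (liftAux f a : L))
    (fun _ _ h => liftAux_rel f h) x
  map_zero' := (liftAux f).map_zero
  map_add' x y := by
    obtain ⟨a, rfl⟩ := mk_surjective V x
    obtain ⟨b, rfl⟩ := mk_surjective V y
    exact map_add (liftAux f) a b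
  map_lie' x y := by
    obtain ⟨a, rfl⟩ := mk_surjective V x
    obtain ⟨b, rfl⟩ := mk_surjective V y
    exact map_mul (liftAux f) a b

theorem lift_of (f : V →+ L) (v : V) : (lift f).toAddMonoidHom (of V v) = f v := liftAux_of f v

theorem lift_unique (f : V →+ L) (F : AntisymLieHom (FreeLie V) L)
    (h : ∀ v, F.toAddMonoidHom (of V v) = f v) (x : FreeLie V) :
    F.toAddMonoidHom x = (lift f).toAddMonoidHom x := by
  obtain ⟨a, rfl⟩ := mk_surjective V x
  let G : FreeNonUnitalNonAssocAlgebra ℤ V →ₙₐ[ℤ] BracketRing L :=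
    { toFun := fun a => F.toAddMonoidHom (mk V a)
      map_zero' := F.toAddMonoidHom.map_zero
      map_add' := fun a b => F.toAddMonoidHom.map_add (mk V a) (mk V b)
      map_mul' := fun a b => F.map_lie' (mk V a) (mk V b)
      map_smul' := fun n a =>
        map_zsmul (AddMonoidHom.comp F.toAddMonoidHom
          (AddMonoidHom.mk' (mk V) fun _ _ => rfl)) n a }
  have hG : G = liftAux f := by
    apply FreeNonUnitalNonAssocAlgebra.hom_ext
    intro v
    rw [liftAux_of]
    exact h v
  exact congrArg (fun H : FreeNonUnitalNonAssocAlgebra ℤ V →ₙₐ[ℤ] BracketRing L => H a) hG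

end

end FreeLie

/-! ### Lyndon words and basic monomials -/

/-- A word in the letters `c_1 < ⋯ < c_k` (represented by `Fin k`) is a Lyndon word if it is nonempty
and strictly smaller than all of its nontrivial cyclic rotations in the lexicographic order. -/
def IsLyndon {k : ℕ} (w : List (Fin k)) : Prop :=
  w ≠ [] ∧ ∀ i < w.length, 0 < i → w < w.rotate i

instance {k : ℕ} : DecidablePred (IsLyndon (k := k)) := fun w => by
  unfold IsLyndon; infer_instance

/-- The set `B(m_1, …, m_k)` of Lyndon words which involve the letter `c_i` precisely `m_i` times. -/
structure LyndonWord {k : ℕ} (m : Fin k → ℕ) where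
  word : List (Fin k)
  isLyndon : IsLyndon word
  count_eq : ∀ i, word.count i = m i

/-- `w = u v`, with `u` the prefix of length `p`, is a factorisation into Lyndon words `u < v`. -/
def IsLyndonCut {k : ℕ} (w : List (Fin k)) (p : ℕ) : Prop :=
  IsLyndon (w.take p) ∧ IsLyndon (w.drop p) ∧ w.take p < w.drop p

instance {k : ℕ} (w : List (Fin k)) : DecidablePred (IsLyndonCut w) := fun p => by
  unfold IsLyndonCut; infer_instance

/-- The length of the first factor `u` in the standard factorisation `w = u v` of a Lyndon word of
length at least two: the factorisation into Lyndon words `u < v` with `u` as long as possible. (Such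
factorisations exist for each Lyndon word of length at least two; the value is `1` for words that
have none.) -/
def stdCut {k : ℕ} (w : List (Fin k)) : ℕ := max 1 (Nat.findGreatest (IsLyndonCut w) (w.length - 1))

theorem stdCut_pos {k : ℕ} (w : List (Fin k)) : 0 < stdCut w := by
  unfold stdCut; omega

theorem stdCut_lt {k : ℕ} (w : List (Fin k)) (h : 2 ≤ w.length) : stdCut w < w.length := by
  have := Nat.findGreatest_le (P := IsLyndonCut w) (w.length - 1)
  unfold stdCut; omega

/-- The parenthesised monomial attached to a word `x` in an alphabet `A`, where `c a` is the letter
in `c_1, …, c_k` underlying `a : A`. If the underlying word is Lyndon, the monomial is parenthesised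
by means of the iterated standard factorisations of the underlying word. -/
def stdMonomial {k : ℕ} {A : Type*} (c : A → Fin k) : (x : List A) → x ≠ [] → FreeMagma A
  | [], h => absurd rfl h
  | [a], _ => FreeMagma.of a
  | a :: b :: l, _ =>
    stdMonomial c ((a :: b :: l).take (stdCut ((a :: b :: l).map c)))
        (by
          have := stdCut_pos ((a :: b :: l).map c)
          rw [← List.length_pos_iff, List.length_take]
          exact lt_min this (by simp)) *
      stdMonomial c ((a :: b :: l).drop (stdCut ((a :: b :: l).map c)))
        (by
          have := stdCut_lt ((a :: b :: l).map c) (by simp)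
          rw [← List.length_pos_iff, List.length_drop]
          rw [List.length_map] at this
          omega)
  termination_by x => x.length
  decreasing_by
    · have := stdCut_lt ((a :: b :: l).map c) (by simp)
      rw [List.length_map] at this
      rw [List.length_take]
      omega
    · have := stdCut_pos ((a :: b :: l).map c)
      rw [List.length_drop]
      simp only [List.length_cons]
      omega

/-- The label `(i, j)` of the letter at position `n` of `u`, when `u` is labelled so that the labels
`(i, 1), …, (i, m_i)` of the letter `c_i` increase from left to right: `i` is the letter and `j`
counts the previous occurrences of this letter (so that `j` starts at `0`). -/
def LyndonWord.label {k : ℕ} {m : Fin k → ℕ} (u : LyndonWord m) (n : Fin u.word.length) :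
    Σ i, Fin (m i) :=
  ⟨u.word[n], ⟨(u.word.take n).count u.word[n], by
    rw [← u.count_eq u.word[n]]
    have h : (u.word.take (n + 1)).count u.word[n] = (u.word.take n).count u.word[n] + 1 := by
      rw [List.take_add_one, List.count_append]
      simp
    have h' := (List.take_sublist (n + 1) u.word).count_le u.word[n]
    omega⟩⟩

/-- The labelled word obtained from `u`. -/
def LyndonWord.labels {k : ℕ} {m : Fin k → ℕ} (u : LyndonWord m) : List (Σ i, Fin (m i)) :=
  List.ofFn u.label

theorem LyndonWord.labels_ne_nil {k : ℕ} {m : Fin k → ℕ} (u : LyndonWord m) : u.labels ≠ [] := by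
  rw [← List.length_pos_iff, LyndonWord.labels, List.length_ofFn, List.length_pos_iff]
  exact u.isLyndon.1

/-- The resolution `ũ` of a Lyndon word `u ∈ B(m_1, …, m_k)`: the multilinear monomial obtained from
the basic monomial of `u` by replacing each letter by its label. -/
def LyndonWord.resolution {k : ℕ} {m : Fin k → ℕ} (u : LyndonWord m) : FreeMagma (Σ i, Fin (m i)) :=
  stdMonomial Sigma.fst u.labels u.labels_ne_nil

/-- The value in a Lie algebra of a parenthesised monomial (the parentheses being Lie brackets) after
substituting `v a` for the letter `a`. -/
def evalMonomial {A L : Type*} [AntisymLieRing L] (v : A → L) : FreeMagma A → L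
  | .of a => v a
  | .mul s t => ⁅evalMonomial v s, evalMonomial v t⁆

/-! ### Multilinearity of resolutions -/

/-- The letters of a monomial, from left to right. -/
def leaves {A : Type*} : FreeMagma A → List A
  | .of a => [a]
  | .mul s t => leaves s ++ leaves t

theorem leaves_stdMonomial {k : ℕ} {A : Type*} (c : A → Fin k) (x : List A) (h : x ≠ []) :
    leaves (stdMonomial c x h) = x := by
  induction x, h using stdMonomial.induct (c := c) with
  | case1 a => rw [stdMonomial]; rfl
  | case2 a b l _ _ ih₂ ih₁ =>
    rw [stdMonomial]
    change leaves _ ++ leaves _ = _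
    rw [ih₁, ih₂, List.take_append_drop]

theorem evalMonomial_update_of_count_zero {A L : Type*} [DecidableEq A] [AntisymLieRing L]
    (v : A → L) (a : A) (x : L) (t : FreeMagma A) (ht : (leaves t).count a = 0) :
    evalMonomial (Function.update v a x) t = evalMonomial v t := by
  induction t with
  | ih1 b =>
    have hb : b ≠ a := by
      rintro rfl
      simp [leaves] at ht
    exact Function.update_of_ne hb x v
  | ih2 s t ihs iht =>
    have h : (leaves s).count a + (leaves t).count a = 0 := by
      rw [← List.count_append]; exact ht
    change ⁅_, _⁆ = ⁅_, _⁆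
    rw [ihs (by omega), iht (by omega)]

theorem exists_evalMonomial_update {A L : Type*} [DecidableEq A] [AntisymLieRing L]
    (v : A → L) (a : A) (t : FreeMagma A) (ht : (leaves t).count a = 1) :
    ∃ f : L →+ L, ∀ x, evalMonomial (Function.update v a x) t = f x := by
  induction t with
  | ih1 b =>
    have hb : b = a := by
      by_contra hb
      simp [leaves, hb] at ht
    subst hb
    exact ⟨AddMonoidHom.id L, fun x => by
      change Function.update v b x b = x
      exact Function.update_self b x v⟩
  | ih2 s t ihs iht =>
    have h : (leaves s).count a + (leaves t).count a = 1 := by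
      rw [← List.count_append]; exact ht
    rcases Nat.eq_zero_or_pos ((leaves s).count a) with h0 | h0
    · obtain ⟨f, hf⟩ := iht (by omega)
      refine ⟨(AddMonoidHom.mk' (fun y => ⁅evalMonomial v s, y⁆)
        (AntisymLieRing.lie_add _)).comp f, fun x => ?_⟩
      change ⁅_, _⁆ = ⁅_, _⁆
      rw [evalMonomial_update_of_count_zero v a x s h0, hf]
    · obtain ⟨f, hf⟩ := ihs (by omega)
      refine ⟨(AddMonoidHom.mk' (fun y => ⁅y, evalMonomial v t⁆)
        (fun y z => AntisymLieRing.add_lie y z _)).comp f, fun x => ?_⟩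
      change ⁅_, _⁆ = ⁅_, _⁆
      rw [evalMonomial_update_of_count_zero v a x t (by omega), hf]

theorem LyndonWord.label_injective {k : ℕ} {m : Fin k → ℕ} (u : LyndonWord m) :
    Function.Injective u.label := by
  have key : ∀ n n' : Fin u.word.length, n < n' → u.label n ≠ u.label n' := by
    intro n n' hlt h
    have h1 : u.word[n] = u.word[n'] := congrArg Sigma.fst h
    have h2 : (u.word.take n).count u.word[n] = (u.word.take n').count u.word[n'] :=
      congrArg (fun p : Σ i, Fin (m i) => (p.2 : ℕ)) h
    have h3 : (u.word.take (n + 1)).count u.word[n] = (u.word.take n).count u.word[n] + 1 := by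
      rw [List.take_add_one, List.count_append]
      simp
    have h4 : (u.word.take (n + 1)).count u.word[n] ≤ (u.word.take n').count u.word[n] :=
      (List.take_sublist_take_left (by exact_mod_cast hlt)).count_le _
    rw [← h1] at h2
    omega
  intro n n' h
  rcases lt_trichotomy n n' with hlt | heq | hlt
  · exact absurd h (key _ _ hlt)
  · exact heq
  · exact absurd h.symm (key _ _ hlt)

theorem LyndonWord.label_bijective {k : ℕ} {m : Fin k → ℕ} (u : LyndonWord m) :
    Function.Bijective u.label := by
  rw [Fintype.bijective_iff_injective_and_card]
  refine ⟨u.label_injective, ?_⟩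
  rw [Fintype.card_fin, Fintype.card_sigma]
  simp only [Fintype.card_fin]
  rw [Finset.sum_congr rfl fun i _ => (u.count_eq i).symm]
  have := Multiset.sum_count_eq_card (s := Finset.univ) (m := (u.word : Multiset (Fin k)))
    (fun a _ => Finset.mem_univ a)
  simpa using this.symm

theorem LyndonWord.count_leaves_resolution {k : ℕ} {m : Fin k → ℕ} (u : LyndonWord m)
    (p : Σ i, Fin (m i)) : (leaves u.resolution).count p = 1 := by
  rw [LyndonWord.resolution, leaves_stdMonomial]
  apply List.count_eq_one_of_mem
  · exact List.nodup_ofFn.mpr u.label_injective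
  · rw [LyndonWord.labels, List.mem_ofFn]
    exact u.label_bijective.2 p

/-! ### The maps `β_u` and `β̃_u` -/

section

variable {k : ℕ} (V : Fin k → Type*) [∀ i, AddCommGroup (V i)]

/-- `V_1^{⊗ m_1} ⊗ ⋯ ⊗ V_k^{⊗ m_k}`: the tensor product over `ℤ` of the family with `m_i` factors
`V_i`, the factors being indexed by the pairs `(i, j)` with `j < m_i`. -/
abbrev MixedTensorPower (m : Fin k → ℕ) : Type _ := ⨂[ℤ] p : (Σ i, Fin (m i)), V p.1

/-- The multilinear map `(v_i^j) ↦ ũ(v_1^1, …, v_1^{m_1}, …, v_k^1, …, v_k^{m_k})`. -/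
noncomputable def betaMultilinear {m : Fin k → ℕ} (u : LyndonWord m) :
    MultilinearMap ℤ (fun p : (Σ i, Fin (m i)) => V p.1) (FreeLie (⨁ i, V i)) where
  toFun v := evalMonomial (fun p => FreeLie.of (⨁ i, V i) (DirectSum.of V p.1 (v p))) u.resolution
  map_update_add' v p x y := by
    have h : ∀ z : V p.1, (fun q : (Σ i, Fin (m i)) => FreeLie.of (⨁ i, V i)
        (DirectSum.of V q.1 (Function.update v p z q))) =
        Function.update (fun q => FreeLie.of (⨁ i, V i) (DirectSum.of V q.1 (v q))) p
          (FreeLie.of (⨁ i, V i) (DirectSum.of V p.1 z)) := fun z => funext fun q =>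
      Function.apply_update (fun q z => FreeLie.of (⨁ i, V i) (DirectSum.of V q.1 z)) v p z q
    obtain ⟨f, hf⟩ := exists_evalMonomial_update
      (fun q : (Σ i, Fin (m i)) => FreeLie.of (⨁ i, V i) (DirectSum.of V q.1 (v q))) p u.resolution
      (by convert u.count_leaves_resolution p)
    rw [h, h, h, hf, hf, hf, map_add, map_add, map_add]
  map_update_smul' v p n x := by
    have h : ∀ z : V p.1, (fun q : (Σ i, Fin (m i)) => FreeLie.of (⨁ i, V i)
        (DirectSum.of V q.1 (Function.update v p z q))) =
        Function.update (fun q => FreeLie.of (⨁ i, V i) (DirectSum.of V q.1 (v q))) p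
          (FreeLie.of (⨁ i, V i) (DirectSum.of V p.1 z)) := fun z => funext fun q =>
      Function.apply_update (fun q z => FreeLie.of (⨁ i, V i) (DirectSum.of V q.1 z)) v p z q
    obtain ⟨f, hf⟩ := exists_evalMonomial_update
      (fun q : (Σ i, Fin (m i)) => FreeLie.of (⨁ i, V i) (DirectSum.of V q.1 (v q))) p u.resolution
      (by convert u.count_leaves_resolution p)
    rw [h, h, hf, hf, map_zsmul, map_zsmul, map_zsmul]

/-- `β_u : V_1^{⊗ m_1} ⊗ ⋯ ⊗ V_k^{⊗ m_k} → Lie[V_1 ⊕ ⋯ ⊕ V_k]`. -/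
noncomputable def beta {m : Fin k → ℕ} (u : LyndonWord m) :
    MixedTensorPower V m →+ FreeLie (⨁ i, V i) :=
  (PiTensorProduct.lift (betaMultilinear V u)).toAddMonoidHom

/-- `β̃_u : Lie[V_1^{⊗ m_1} ⊗ ⋯ ⊗ V_k^{⊗ m_k}] → Lie[V_1 ⊕ ⋯ ⊕ V_k]`, the extension of `β_u` to a
homomorphism of Lie algebras. -/
noncomputable def betaTilde {m : Fin k → ℕ} (u : LyndonWord m) :
    AntisymLieHom (FreeLie (MixedTensorPower V m)) (FreeLie (⨁ i, V i)) :=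
  FreeLie.lift (beta V u)

/-- The direct sum `⊕ β̃_u` of all the maps `β̃_u`, over all `m_1, …, m_k ≥ 0` and all Lyndon words
`u ∈ B(m_1, …, m_k)`, as a homomorphism of abelian groups. -/
noncomputable def sumBetaTilde :
    (⨁ u : (Σ m : Fin k → ℕ, LyndonWord m), FreeLie (MixedTensorPower V u.1)) →+ FreeLie (⨁ i, V i) :=
  letI : DecidableEq (Σ m : Fin k → ℕ, LyndonWord m) := Classical.decEq _
  DirectSum.toAddMonoid fun u => (betaTilde V u.2).toAddMonoidHom

end

end HiltonMilnor

/-!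
The proof is Lazard elimination, carried out one Lyndon word at a time.

Bases of the groups `V_i` reduce the theorem to sets. Let `X` be the disjoint union of the bases,
coloured by `i`. The group `V_1^{⊗ m_1} ⊗ ⋯ ⊗ V_k^{⊗ m_k}` attached to a Lyndon word `u` has as
basis the words in `X` whose colour word is `u`, and `β_u` sends such a word to its standard bracketing
(`betaTilde_sourceMap`). So it has to be shown that the free Lie algebra on `X` is the direct sum,
over all Lyndon words `w`, of the free Lie algebras on the words of colour `w`.

For disjoint sets `S` and `T`, the free Lie algebra on `S ∪ T` is the semidirect product of the free
Lie algebra on `S` and the free Lie algebra on the elements `⁅s₁, ⁅s₂, …, ⁅sₙ, t⁆…⁆⁆`; this only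
uses extensions of maps to derivations, and does not need `⁅u, u⁆ = 0`. The two halves that are used
are a retraction (`FL.exists_elimination`) for the injectivity, and a spanning statement with
weights (`LieSpan.exists_add`) for the surjectivity.

Fix a bound `N` and eliminate the Lyndon words of length at most `N` in increasing order. When those
in a lower set `E` are gone, the remaining letters are the Lyndon words outside `E` which are single
letters or whose standard left factor is in `E` (`IsLetter`). If `w` is the smallest remaining
Lyndon word, then the letters after its elimination are the words `w ⋯ w r` for the letters `r ≠ w`
(`IsLetter.of_insert`, `IsLetter.append`), and the brackets produced by the elimination are the
standard ones. This rests on the fact that, for Lyndon words `u < v`, the factorisation `u v` is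
standard if and only if `v` is a single letter or has a standard left factor which is at most `u`
(`stdLeft_stdRight_le`, `stdCut_append`). The bound is needed because the set of all remaining
Lyndon words may have no smallest element: `⋯ < aab < ab < b`. It is harmless, as an element of the direct
sum involves finitely many words, and the elimination preserves the weight of a Lie monomial.
-/

namespace HiltonMilnor

/-! ### Lexicographic order on words -/

section Lex

variable {α : Type*} [LinearOrder α]

theorem append_lt_append_iff (a : List α) {x y : List α} : a ++ x < a ++ y ↔ x < y := by
  have h : StrictMono fun x : List α => a ++ x := fun x y h => List.append_left_lt h
  exact h.lt_iff_lt

theorem le_append (a b : List α) : a ≤ a ++ b := by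
  induction a with
  | nil => exact not_lt.mp (List.not_lt_nil b)
  | cons x a ih => exact List.cons_le_cons x ih

theorem append_lt_append_of_lt {a b : List α} (h : a < b) (hp : ¬ a <+: b) (x y : List α) :
    a ++ x < b ++ y := by
  induction a generalizing b with
  | nil => exact absurd List.nil_prefix hp
  | cons s a ih =>
    cases b with
    | nil => exact absurd h (List.not_lt_nil _)
    | cons t b =>
      rw [List.cons_append, List.cons_append, List.cons_lt_cons_iff]
      rcases List.cons_lt_cons_iff.mp h with h' | ⟨rfl, h'⟩
      · exact Or.inl h'
      · exact Or.inr ⟨rfl, ih h' fun hp' => hp (by simpa using hp')⟩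

theorem append_lt_append_of_lt_of_length_le {a b : List α} (h : a < b) (hl : b.length ≤ a.length)
    (x y : List α) : a ++ x < b ++ y :=
  append_lt_append_of_lt h (fun hp => h.ne (hp.eq_of_length_le hl)) x y

end Lex

/-! ### Lyndon words and their standard factorisations -/

section Lyndon

variable {k : ℕ}

theorem isLyndon_iff_forall_rotation {w : List (Fin k)} :
    IsLyndon w ↔ w ≠ [] ∧ ∀ u v, u ≠ [] → v ≠ [] → w = u ++ v → w < v ++ u := by
  refine and_congr_right fun _ => ⟨fun h u v hu hv hw => ?_, fun h i hi hi0 => ?_⟩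
  · have := List.length_pos_iff.mpr hu
    have := List.length_pos_iff.mpr hv
    have h' := h u.length (by rw [hw, List.length_append]; omega) (by omega)
    rwa [hw, List.rotate_append_length_eq, ← hw] at h'
  · rw [List.rotate_eq_drop_append_take hi.le]
    refine h _ _ ?_ ?_ (List.take_append_drop i w).symm
    · rw [← List.length_pos_iff, List.length_take]; omega
    · rw [← List.length_pos_iff, List.length_drop]; omega

/-- A Lyndon word is smaller than each of its proper suffixes. -/
theorem IsLyndon.lt_suffix {u v : List (Fin k)} (h : IsLyndon (u ++ v)) (hu : u ≠ [])
    (hv : v ≠ []) : u ++ v < v := by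
  have hrot := (isLyndon_iff_forall_rotation.mp h).2
  by_contra hlt
  have hvw : v < u ++ v := lt_of_le_of_ne (not_lt.mp hlt) fun e => hu (by simpa using e)
  -- If `w = u v = v v'`, the rotation `v u` gives `v' < u`, and the rotation `v' v` gives `u ≤ v'`.
  by_cases hp : v <+: u ++ v
  · obtain ⟨v', hv'⟩ := hp
    have hlen : v'.length = u.length := by
      have := congrArg List.length hv'
      simp only [List.length_append] at this
      omega
    have hv'0 : v' ≠ [] := by
      rw [← List.length_pos_iff, hlen]; exact List.length_pos_iff.mpr hu
    have h1 : v' < u := by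
      have := hrot u v hu hv rfl
      rwa [← hv', append_lt_append_iff] at this
    have h2 := append_lt_append_of_lt_of_length_le h1 hlen.ge v v
    exact lt_asymm h2 (hrot v v' hv hv'0 hv'.symm)
  · have := append_lt_append_of_lt hvw hp u []
    rw [List.append_nil] at this
    exact lt_asymm this (hrot u v hu hv rfl)

theorem isLyndon_iff_forall_suffix {w : List (Fin k)} :
    IsLyndon w ↔ w ≠ [] ∧ ∀ u v, u ≠ [] → v ≠ [] → w = u ++ v → w < v := by
  refine ⟨fun h => ⟨h.1, fun u v hu hv hw => ?_⟩, fun h => isLyndon_iff_forall_rotation.mpr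
    ⟨h.1, fun u v hu hv hw => (h.2 u v hu hv hw).trans_le (le_append v u)⟩⟩
  subst hw
  exact h.lt_suffix hu hv

theorem isLyndon_singleton (a : Fin k) : IsLyndon [a] :=
  ⟨by simp, fun i hi hi0 => by simp at hi; omega⟩

theorem IsLyndon.append {u v : List (Fin k)} (hu : IsLyndon u) (hv : IsLyndon v) (h : u < v) :
    IsLyndon (u ++ v) := by
  have key : u ++ v < v := by
    by_cases hp : u <+: v
    · obtain ⟨v', rfl⟩ := hp
      rw [append_lt_append_iff]
      exact hv.lt_suffix hu.1 (by rintro rfl; simp at h)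
    · simpa using append_lt_append_of_lt h hp v []
  refine isLyndon_iff_forall_suffix.mpr ⟨by simp [hu.1], fun p s hp hs e => ?_⟩
  rcases List.append_eq_append_iff.mp e with ⟨v', rfl, hv'⟩ | ⟨u', hu', rfl⟩
  · rcases eq_or_ne v' [] with rfl | hv0
    · rw [List.nil_append] at hv'; rwa [← hv']
    · subst hv'
      exact key.trans (hv.lt_suffix hv0 hs)
  · rcases eq_or_ne u' [] with rfl | hu0
    · exact key
    · subst hu'
      refine append_lt_append_of_lt_of_length_le (hu.lt_suffix hp hu0) ?_ _ _
      simp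

/-- Cutting a Lyndon word before its smallest proper suffix gives two Lyndon words. -/
theorem IsLyndon.exists_cut {w : List (Fin k)} (h : IsLyndon w) (hl : 2 ≤ w.length) :
    ∃ p, p ≤ w.length - 1 ∧ IsLyndonCut w p := by
  obtain ⟨p, hp, hmin⟩ := Finset.exists_min_image (Finset.Icc 1 (w.length - 1)) (fun p => w.drop p)
    ⟨1, by simp; omega⟩
  rw [Finset.mem_Icc] at hp
  have hmin' : ∀ s t, s ≠ [] → t ≠ [] → w = s ++ t → w.drop p ≤ t := by
    intro s t hs ht e
    have h1 := List.length_pos_iff.mpr hs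
    have h2 := List.length_pos_iff.mpr ht
    have := hmin s.length (by rw [Finset.mem_Icc, e, List.length_append]; omega)
    rwa [e, List.drop_left, ← e] at this
  have hu0 : w.take p ≠ [] := by rw [← List.length_pos_iff, List.length_take]; omega
  have hv0 : w.drop p ≠ [] := by rw [← List.length_pos_iff, List.length_drop]; omega
  have hw := List.take_append_drop p w
  set u := w.take p
  set v := w.drop p
  have hwv : w < v := by
    have := (hw ▸ h : IsLyndon (u ++ v)).lt_suffix hu0 hv0
    rwa [hw] at this
  refine ⟨p, hp.2, isLyndon_iff_forall_suffix.mpr ⟨hu0, fun s t hs ht e => ?_⟩,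
    isLyndon_iff_forall_suffix.mpr ⟨hv0, fun s t hs ht e => ?_⟩, ?_⟩
  · change u = s ++ t at e
    by_contra hlt
    have htu : t < u := lt_of_le_of_ne (not_lt.mp hlt) fun e' => hs (by
      rw [← e'] at e; simpa using e)
    have hst : w = s ++ (t ++ v) := by rw [← hw, e, List.append_assoc]
    have hwt : w < t ++ v := by
      rw [hst] at h ⊢; exact h.lt_suffix hs (by simp [ht])
    by_cases hpre : t <+: u
    · obtain ⟨z, hz⟩ := hpre
      rw [← hw, ← hz, List.append_assoc, append_lt_append_iff] at hwt
      exact absurd hwt (not_lt.mpr (hmin' t (z ++ v) ht (by simp [hv0])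
        (by rw [← hw, ← hz, List.append_assoc])))
    · have := append_lt_append_of_lt htu hpre v v
      rw [hw] at this
      exact lt_asymm this hwt
  · change v = s ++ t at e
    refine lt_of_le_of_ne (hmin' (u ++ s) t (by simp [hs]) ht
      (by rw [← hw, e, List.append_assoc])) fun e' => hs ?_
    rw [← e'] at e; exact List.self_eq_append_left.mp e
  · exact (hw ▸ le_append u v : u ≤ w).trans_lt hwv

/-- The left factor of the standard factorisation. -/
def stdLeft (w : List (Fin k)) : List (Fin k) := w.take (stdCut w)

/-- The right factor of the standard factorisation. -/
def stdRight (w : List (Fin k)) : List (Fin k) := w.drop (stdCut w)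

theorem stdLeft_append_stdRight (w : List (Fin k)) : stdLeft w ++ stdRight w = w :=
  List.take_append_drop _ _

theorem stdRight_ne_nil {w : List (Fin k)} (hl : 2 ≤ w.length) : stdRight w ≠ [] := by
  rw [← List.length_pos_iff, stdRight, List.length_drop]
  have := stdCut_lt w hl
  omega

theorem IsLyndon.isLyndonCut_stdCut {w : List (Fin k)} (h : IsLyndon w) (hl : 2 ≤ w.length) :
    IsLyndonCut w (stdCut w) := by
  obtain ⟨p, hp, hcut⟩ := h.exists_cut hl
  have h1 := Nat.findGreatest_spec hp hcut
  have h2 : 1 ≤ Nat.findGreatest (IsLyndonCut w) (w.length - 1) := by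
    rcases Nat.eq_zero_or_pos (Nat.findGreatest (IsLyndonCut w) (w.length - 1)) with h0 | h0
    · rw [h0] at h1
      exact absurd rfl h1.1.1
    · exact h0
  rwa [stdCut, max_eq_right h2]

theorem le_stdCut {w : List (Fin k)} {p : ℕ} (hp : p < w.length) (h : IsLyndonCut w p) :
    p ≤ stdCut w :=
  (Nat.le_findGreatest (by omega) h).trans (le_max_right _ _)

theorem isLyndonCut_append_iff {u v : List (Fin k)} :
    IsLyndonCut (u ++ v) u.length ↔ IsLyndon u ∧ IsLyndon v ∧ u < v := by
  rw [IsLyndonCut, List.take_left, List.drop_left]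

theorem IsLyndon.stdLeft {w : List (Fin k)} (h : IsLyndon w) (hl : 2 ≤ w.length) :
    IsLyndon (stdLeft w) := (h.isLyndonCut_stdCut hl).1

theorem IsLyndon.stdRight {w : List (Fin k)} (h : IsLyndon w) (hl : 2 ≤ w.length) :
    IsLyndon (stdRight w) := (h.isLyndonCut_stdCut hl).2.1

theorem IsLyndon.stdLeft_lt_stdRight {w : List (Fin k)} (h : IsLyndon w) (hl : 2 ≤ w.length) :
    HiltonMilnor.stdLeft w < HiltonMilnor.stdRight w := (h.isLyndonCut_stdCut hl).2.2

theorem length_stdLeft {w : List (Fin k)} (hl : 2 ≤ w.length) :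
    (stdLeft w).length = stdCut w := by
  rw [stdLeft, List.length_take, min_eq_left (stdCut_lt w hl).le]

theorem stdLeft_lt {w : List (Fin k)} (hl : 2 ≤ w.length) : stdLeft w < w := by
  refine lt_of_le_of_ne ?_ fun e => ?_
  · have := le_append (stdLeft w) (stdRight w)
    rwa [stdLeft_append_stdRight] at this
  · have h1 := length_stdLeft hl
    rw [e] at h1
    have := stdCut_lt w hl
    omega

/-- If `w = u v` is a standard factorisation, then `v = v' v''` has `v' ≤ u`: otherwise `u v'` would
be a longer left factor. -/
theorem stdLeft_stdRight_le {w : List (Fin k)} (h : IsLyndon w) (hl : 2 ≤ w.length)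
    (hr : 2 ≤ (stdRight w).length) : stdLeft (stdRight w) ≤ stdLeft w := by
  by_contra hlt
  rw [not_le] at hlt
  have hu := h.stdLeft hl
  have hv := h.stdRight hl
  have hcut := hu.append (hv.stdLeft hr) hlt
  have hlt' : stdLeft w ++ stdLeft (stdRight w) < stdRight (stdRight w) :=
    (hcut.lt_suffix hu.1 (hv.stdLeft hr).1).trans (hv.stdLeft_lt_stdRight hr)
  have hw : (stdLeft w ++ stdLeft (stdRight w)) ++ stdRight (stdRight w) = w := by
    rw [List.append_assoc, stdLeft_append_stdRight, stdLeft_append_stdRight]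
  have hc := isLyndonCut_append_iff.mpr ⟨hcut, hv.stdRight hr, hlt'⟩
  rw [hw] at hc
  have h1 := List.length_pos_iff.mpr (stdRight_ne_nil hr)
  have h2 := List.length_pos_iff.mpr (hv.stdLeft hr).1
  have h3 := congrArg List.length hw
  rw [List.length_append] at h3
  have h4 := le_stdCut (by omega) hc
  rw [List.length_append, length_stdLeft hl] at h4
  omega

/-- If the left factor of a Lyndon word is at most `u`, then each proper prefix of the word has a
suffix which is at most `u`, namely one of the left factors of the iterated right factors, or a
prefix of it. -/
theorem exists_suffix_le {u z t : List (Fin k)} (h : IsLyndon (z ++ t)) (hz : z ≠ []) (ht : t ≠ [])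
    (hle : stdLeft (z ++ t) ≤ u) : ∃ p s, z = p ++ s ∧ s ≠ [] ∧ s ≤ u := by
  induction hn : z.length using Nat.strong_induction_on generalizing z with
  | _ n ih =>
    have hl : 2 ≤ (z ++ t).length := by
      have := List.length_pos_iff.mpr hz
      have := List.length_pos_iff.mpr ht
      rw [List.length_append]; omega
    have hw := stdLeft_append_stdRight (z ++ t)
    have short : ∀ s, z ++ s = stdLeft (z ++ t) → ∃ p s, z = p ++ s ∧ s ≠ [] ∧ s ≤ u :=
      fun s hs => ⟨[], z, rfl, hz, ((le_append z s).trans_eq hs).trans hle⟩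
    rcases List.append_eq_append_iff.mp hw with ⟨z', hz', ht'⟩ | ⟨s, hs, -⟩
    · rcases eq_or_ne z' [] with rfl | hz0
      · exact short [] (by rw [List.append_nil] at hz' ⊢; exact hz')
      · have hr : 2 ≤ (stdRight (z ++ t)).length := by
          have := List.length_pos_iff.mpr hz0
          have := List.length_pos_iff.mpr ht
          rw [ht', List.length_append]; omega
        have hle' := (stdLeft_stdRight_le h hl hr).trans hle
        have hlyn := h.stdRight hl
        rw [ht'] at hlyn hle'
        have hlen : z'.length < n := by
          have h1 := List.length_pos_iff.mpr (h.stdLeft hl).1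
          have h2 := congrArg List.length hz'
          rw [List.length_append] at h2
          omega
        obtain ⟨p, s, hps, hs, hsu⟩ := ih _ hlen hlyn hz0 hle' rfl
        exact ⟨stdLeft (z ++ t) ++ p, s, by rw [List.append_assoc, ← hps, ← hz'], hs, hsu⟩
    · exact short s hs.symm

/-- For Lyndon words `u < v`, the factorisation `u v` is standard as soon as `v` is a letter or the
left factor of `v` is at most `u`. -/
theorem stdCut_append {u v : List (Fin k)} (hu : IsLyndon u) (hv : IsLyndon v) (h : u < v)
    (hv' : 2 ≤ v.length → stdLeft v ≤ u) : stdCut (u ++ v) = u.length := by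
  have hu1 := List.length_pos_iff.mpr hu.1
  have hv1 := List.length_pos_iff.mpr hv.1
  have hl : 2 ≤ (u ++ v).length := by rw [List.length_append]; omega
  have hlyn := hu.append hv h
  refine le_antisymm ?_
    (le_stdCut (by rw [List.length_append]; omega) (isLyndonCut_append_iff.mpr ⟨hu, hv, h⟩))
  by_contra hlt
  rw [not_le, ← length_stdLeft hl] at hlt
  have hlynl := hlyn.stdLeft hl
  have hr0 := stdRight_ne_nil hl
  rcases List.append_eq_append_iff.mp (stdLeft_append_stdRight (u ++ v)) with
    ⟨z, hz, -⟩ | ⟨z, hz, hv2⟩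
  · have := congrArg List.length hz
    rw [List.length_append] at this
    omega
  · rw [hz] at hlynl
    have hz0 : z ≠ [] := by
      rintro rfl
      rw [hz, List.append_nil] at hlt
      omega
    have hle := hv' (by
      have := List.length_pos_iff.mpr hz0
      have := List.length_pos_iff.mpr hr0
      rw [hv2, List.length_append]; omega)
    rw [hv2] at hle hv
    obtain ⟨p, s, rfl, hs, hsu⟩ := exists_suffix_le hv hz0 hr0 hle
    rw [← List.append_assoc] at hlynl
    have h1 := hlynl.lt_suffix (by simp [hu.1]) hs
    rw [List.append_assoc] at h1
    exact absurd (((le_append u (p ++ s)).trans_lt h1).trans_le hsu) (lt_irrefl u)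

end Lyndon

/-! ### Antisymmetric Lie algebras, actions and semidirect products -/

section LieBasics

variable {L M N : Type*} [AntisymLieRing L] [AntisymLieRing M] [AntisymLieRing N]

/-- The operator `⁅u, -⁆`. -/
def ad (u : L) : L →+ L := AddMonoidHom.mk' (fun v => ⁅u, v⁆) (AntisymLieRing.lie_add u)

theorem bracket_add (u v w : L) : ⁅u, v + w⁆ = ⁅u, v⁆ + ⁅u, w⁆ := AntisymLieRing.lie_add u v w

theorem add_bracket (u v w : L) : ⁅u + v, w⁆ = ⁅u, w⁆ + ⁅v, w⁆ := AntisymLieRing.add_lie u v w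

theorem bracket_skew (u v : L) : ⁅u, v⁆ = -⁅v, u⁆ := AntisymLieRing.lie_skew u v

theorem bracket_zero (u : L) : ⁅u, (0 : L)⁆ = 0 := map_zero (ad u)

theorem bracket_neg (u v : L) : ⁅u, -v⁆ = -⁅u, v⁆ := map_neg (ad u) v

theorem bracket_sub (u v w : L) : ⁅u, v - w⁆ = ⁅u, v⁆ - ⁅u, w⁆ := map_sub (ad u) v w

theorem zero_bracket (u : L) : ⁅(0 : L), u⁆ = 0 := by rw [bracket_skew, bracket_zero, neg_zero]

theorem neg_bracket (u v : L) : ⁅-u, v⁆ = -⁅u, v⁆ := by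
  rw [bracket_skew, bracket_neg, ← bracket_skew]

theorem bracket_leibniz (u v w : L) : ⁅u, ⁅v, w⁆⁆ = ⁅⁅u, v⁆, w⁆ + ⁅v, ⁅u, w⁆⁆ := by
  have h := AntisymLieRing.jacobi u v w
  rw [bracket_skew w ⁅u, v⁆, bracket_skew w u, bracket_neg] at h
  rw [← sub_eq_zero, ← h]
  abel

theorem bracket_bracket (u v w : L) : ⁅⁅u, v⁆, w⁆ = ⁅u, ⁅v, w⁆⁆ - ⁅v, ⁅u, w⁆⁆ := by
  rw [bracket_leibniz u v w]; abel

/-- An additive map which is compatible with the brackets. -/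
def IsLieHom (F : L →+ M) : Prop := ∀ u v, F ⁅u, v⁆ = ⁅F u, F v⁆

theorem IsLieHom.comp {G : M →+ N} {F : L →+ M} (hG : IsLieHom G) (hF : IsLieHom F) :
    IsLieHom (G.comp F) := fun u v => by
  simp only [AddMonoidHom.comp_apply, hF u v, hG (F u) (F v)]

theorem isLieHom_id : IsLieHom (AddMonoidHom.id L) := fun _ _ => rfl

/-- The iterated bracket `⁅x₁, ⁅x₂, …, ⁅xₙ, y⁆…⁆⁆`. -/
def adList (l : List L) (y : L) : L := l.foldr (fun x z => ⁅x, z⁆) y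

theorem IsLieHom.map_adList {F : L →+ M} (hF : IsLieHom F) (l : List L) (y : L) :
    F (adList l y) = adList (l.map F) (F y) := by
  induction l with
  | nil => rfl
  | cons x l ih => exact (hF _ _).trans (congrArg (Bracket.bracket (F x)) ih)

/-- The Lie algebra structure on a subgroup which is closed under brackets. -/
@[reducible] def antisymLieRingOfSubgroup (H : AddSubgroup L) (hH : ∀ u ∈ H, ∀ v ∈ H, ⁅u, v⁆ ∈ H) :
    AntisymLieRing H where
  bracket u v := ⟨⁅(u : L), (v : L)⁆, hH u u.2 v v.2⟩
  add_lie u v w := Subtype.ext (add_bracket (u : L) v w)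
  lie_add u v w := Subtype.ext (bracket_add (u : L) v w)
  lie_skew u v := Subtype.ext (bracket_skew (u : L) v)
  jacobi u v w := Subtype.ext (AntisymLieRing.jacobi (u : L) v w)

/-- The commutator bracket on the endomorphisms of an abelian group. -/
instance AddMonoid.End.antisymLieRing {A : Type*} [AddCommGroup A] :
    AntisymLieRing (AddMonoid.End A) where
  bracket f g := f * g - g * f
  add_lie u v w := by
    change (u + v) * w - w * (u + v) = (u * w - w * u) + (v * w - w * v)
    noncomm_ring
  lie_add u v w := by
    change u * (v + w) - (v + w) * u = (u * v - v * u) + (u * w - w * u)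
    noncomm_ring
  lie_skew u v := by
    change u * v - v * u = -(v * u - u * v)
    noncomm_ring
  jacobi u v w := by
    change u * (v * w - w * v) - (v * w - w * v) * u + (w * (u * v - v * u) - (u * v - v * u) * w) +
      (v * (w * u - u * w) - (w * u - u * w) * v) = 0
    noncomm_ring

theorem AddMonoid.End.lie_apply {A : Type*} [AddCommGroup A] (f g : AddMonoid.End A) (a : A) :
    ⁅f, g⁆ a = f (g a) - g (f a) := rfl

/-- An action of the Lie algebra `L` on the Lie algebra `M` by derivations. -/
structure LieAction (L M : Type*) [AntisymLieRing L] [AntisymLieRing M] where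
  /-- The additive map underlying the action. -/
  act : L →+ AddMonoid.End M
  lie_act : ∀ u v x, act ⁅u, v⁆ x = act u (act v x) - act v (act u x)
  act_lie : ∀ u x y, act u ⁅x, y⁆ = ⁅act u x, y⁆ + ⁅x, act u y⁆

theorem LieAction.add_act (ρ : LieAction L M) (u v : L) (x : M) :
    ρ.act (u + v) x = ρ.act u x + ρ.act v x := by
  rw [map_add]; rfl

/-- The semidirect product `L ⋉ M` of an action of `L` on `M`: the group `L × M`, with the bracket
`⁅(u, x), (v, y)⁆ = (⁅u, v⁆, ⁅x, y⁆ + u • y - v • x)`. -/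
def Semidirect (_ρ : LieAction L M) : Type _ := L × M

instance (ρ : LieAction L M) : AddCommGroup (Semidirect ρ) := inferInstanceAs (AddCommGroup (L × M))

instance (ρ : LieAction L M) : AntisymLieRing (Semidirect ρ) where
  bracket p q := (⁅p.1, q.1⁆, ⁅p.2, q.2⁆ + ρ.act p.1 q.2 - ρ.act q.1 p.2)
  add_lie p q r := by
    refine Prod.ext (add_bracket p.1 q.1 r.1) ?_
    change ⁅p.2 + q.2, r.2⁆ + ρ.act (p.1 + q.1) r.2 - ρ.act r.1 (p.2 + q.2) =
      (⁅p.2, r.2⁆ + ρ.act p.1 r.2 - ρ.act r.1 p.2) + (⁅q.2, r.2⁆ + ρ.act q.1 r.2 - ρ.act r.1 q.2)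
    rw [add_bracket, ρ.add_act, map_add]
    abel
  lie_add p q r := by
    refine Prod.ext (bracket_add p.1 q.1 r.1) ?_
    change ⁅p.2, q.2 + r.2⁆ + ρ.act p.1 (q.2 + r.2) - ρ.act (q.1 + r.1) p.2 =
      (⁅p.2, q.2⁆ + ρ.act p.1 q.2 - ρ.act q.1 p.2) + (⁅p.2, r.2⁆ + ρ.act p.1 r.2 - ρ.act r.1 p.2)
    rw [bracket_add, ρ.add_act, map_add]
    abel
  lie_skew p q := by
    refine Prod.ext (bracket_skew p.1 q.1) ?_
    change ⁅p.2, q.2⁆ + ρ.act p.1 q.2 - ρ.act q.1 p.2 =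
      -(⁅q.2, p.2⁆ + ρ.act q.1 p.2 - ρ.act p.1 q.2)
    rw [bracket_skew p.2 q.2]
    abel
  jacobi p q r := by
    refine Prod.ext (AntisymLieRing.jacobi p.1 q.1 r.1) ?_
    change (⁅p.2, ⁅q.2, r.2⁆ + ρ.act q.1 r.2 - ρ.act r.1 q.2⁆ +
        ρ.act p.1 (⁅q.2, r.2⁆ + ρ.act q.1 r.2 - ρ.act r.1 q.2) - ρ.act ⁅q.1, r.1⁆ p.2) +
      (⁅r.2, ⁅p.2, q.2⁆ + ρ.act p.1 q.2 - ρ.act q.1 p.2⁆ +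
        ρ.act r.1 (⁅p.2, q.2⁆ + ρ.act p.1 q.2 - ρ.act q.1 p.2) - ρ.act ⁅p.1, q.1⁆ r.2) +
      (⁅q.2, ⁅r.2, p.2⁆ + ρ.act r.1 p.2 - ρ.act p.1 r.2⁆ +
        ρ.act q.1 (⁅r.2, p.2⁆ + ρ.act r.1 p.2 - ρ.act p.1 r.2) - ρ.act ⁅r.1, p.1⁆ q.2) = 0
    rw [← AntisymLieRing.jacobi p.2 q.2 r.2]
    simp only [bracket_add, bracket_sub, map_add, map_sub, ρ.lie_act,
      ρ.act_lie]
    rw [bracket_skew (ρ.act p.1 q.2) r.2, bracket_skew (ρ.act r.1 p.2) q.2,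
      bracket_skew (ρ.act q.1 r.2) p.2]
    abel

theorem Semidirect.lie_def (ρ : LieAction L M) (p q : Semidirect ρ) :
    ⁅p, q⁆ = ((⁅p.1, q.1⁆, ⁅p.2, q.2⁆ + ρ.act p.1 q.2 - ρ.act q.1 p.2) : L × M) := rfl

/-- The group `L` with the zero bracket. -/
def Abelianised (L : Type*) : Type _ := L

instance : AddCommGroup (Abelianised L) := inferInstanceAs (AddCommGroup L)

instance : AntisymLieRing (Abelianised L) where
  bracket _ _ := 0
  add_lie _ _ _ := (add_zero _).symm
  lie_add _ _ _ := (add_zero _).symm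
  lie_skew _ _ := neg_zero.symm
  jacobi _ _ _ := by rw [add_zero, add_zero]

/-- The adjoint action of `L` on its underlying abelian group. -/
def adjointAction (L : Type*) [AntisymLieRing L] : LieAction L (Abelianised L) where
  act := AddMonoidHom.mk' (fun u => (ad u : L →+ L)) fun u v => by
    ext w
    exact add_bracket u v w
  lie_act u v x := bracket_bracket (L := L) u v x
  act_lie u x y := (map_zero (ad u)).trans (add_zero (0 : L)).symm

end LieBasics

/-! ### The free Lie algebra on a set -/

section FL

theorem FreeLie.induction {V : Type*} [AddCommGroup V] {p : FreeLie V → Prop}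
    (of : ∀ v, p (FreeLie.of V v)) (zero : p 0) (add : ∀ x y, p x → p y → p (x + y))
    (neg : ∀ x, p x → p (-x)) (lie : ∀ x y, p x → p y → p ⁅x, y⁆) (x : FreeLie V) : p x := by
  let H : AddSubgroup (FreeLie V) :=
    { carrier := {x | p x}
      zero_mem' := zero
      add_mem' := fun hx hy => add _ _ hx hy
      neg_mem' := fun hx => neg _ hx }
  let _ : AntisymLieRing H := antisymLieRingOfSubgroup H fun u hu v hv => lie u v hu hv
  let f : V →+ H := (FreeLie.of V).codRestrict H of
  let F : AntisymLieHom (FreeLie V) (FreeLie V) :=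
    { H.subtype.comp (FreeLie.lift f).toAddMonoidHom with
      map_lie' := fun u v => congrArg H.subtype ((FreeLie.lift f).map_lie' u v) }
  have h1 := FreeLie.lift_unique (FreeLie.of V) F
    (fun v => congrArg H.subtype (FreeLie.lift_of f v)) x
  have h2 := FreeLie.lift_unique (FreeLie.of V) ⟨AddMonoidHom.id _, fun _ _ => rfl⟩
    (fun v => rfl) x
  have h3 : (((FreeLie.lift f).toAddMonoidHom x : H) : FreeLie V) = x := h1.trans h2.symm
  rw [← h3]
  exact Subtype.property _

/-- The free Lie algebra on a set. -/
abbrev FL (X : Type*) : Type _ := FreeLie (X →₀ ℤ)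

namespace FL

variable {X Y : Type*} {L M : Type*} [AntisymLieRing L] [AntisymLieRing M]

/-- The generators of the free Lie algebra on `X`. -/
noncomputable def gen (x : X) : FL X := FreeLie.of _ (Finsupp.single x 1)

/-- The homomorphism of Lie algebras with prescribed values on the generators. -/
noncomputable def lift (f : X → L) : FL X →+ L :=
  (FreeLie.lift (Finsupp.liftAddHom fun x => zmultiplesHom L (f x))).toAddMonoidHom

theorem isLieHom_lift (f : X → L) : IsLieHom (lift f) := (FreeLie.lift _).map_lie'

theorem lift_gen (f : X → L) (x : X) : lift f (gen x) = f x := by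
  rw [lift, gen, FreeLie.lift_of]
  simp

theorem induction {p : FL X → Prop} (gen : ∀ x, p (gen x)) (zero : p 0)
    (add : ∀ x y, p x → p y → p (x + y)) (neg : ∀ x, p x → p (-x))
    (lie : ∀ x y, p x → p y → p ⁅x, y⁆) (x : FL X) : p x := by
  refine FreeLie.induction (fun v => ?_) zero add neg lie x
  induction v using Finsupp.induction_linear with
  | zero => rwa [map_zero]
  | add f g hf hg => rw [map_add]; exact add _ _ hf hg
  | single a n =>
    have h : Finsupp.single a n = n • Finsupp.single a (1 : ℤ) := by simp
    rw [h, map_zsmul]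
    change p (n • FL.gen a)
    induction n with
    | zero => rwa [zero_smul]
    | succ n ih =>
      rw [add_smul, one_smul]
      exact add _ _ (ih (by simp)) (gen a)
    | pred n ih =>
      rw [sub_smul, one_smul, sub_eq_add_neg]
      exact add _ _ (ih (by simp)) (neg _ (gen a))

theorem hom_ext {F G : FL X →+ L} (hF : IsLieHom F) (hG : IsLieHom G)
    (h : ∀ x, F (gen x) = G (gen x)) (x : FL X) : F x = G x := by
  induction x using induction with
  | gen x => exact h x
  | zero => rw [map_zero, map_zero]
  | add x y hx hy => rw [map_add, map_add, hx, hy]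
  | neg x hx => rw [map_neg, map_neg, hx]
  | lie x y hx hy => rw [hF, hG, hx, hy]

/-- Every map from the generators extends to a derivation. -/
theorem exists_derivation (d : X → FL X) : ∃ D : AddMonoid.End (FL X),
    (∀ x y, D ⁅x, y⁆ = ⁅D x, y⁆ + ⁅x, D y⁆) ∧ ∀ x, D (gen x) = d x := by
  -- A derivation is the second component of a section of `L ⋉ L → L`, with the bracket of the
  -- second factor zero.
  let F : FL X →+ Semidirect (adjointAction (FL X)) := lift fun x => (gen x, d x)
  have hF : IsLieHom F := isLieHom_lift _
  have hgen : ∀ x, F (gen x) = (gen x, d x) := fun x => lift_gen _ x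
  have h1 : ∀ x, (F x).1 = x := hom_ext
    (F := (AddMonoidHom.fst (FL X) (Abelianised (FL X))).comp F)
    (fun u v => congrArg Prod.fst (hF u v)) isLieHom_id (fun x => congrArg Prod.fst (hgen x))
  let D : FL X →+ FL X := (AddMonoidHom.snd (FL X) (Abelianised (FL X))).comp F
  refine ⟨D, fun x y => ?_, fun x => congrArg Prod.snd (hgen x)⟩
  have h2 : D ⁅x, y⁆ = 0 + ⁅(F x).1, D y⁆ - ⁅(F y).1, D x⁆ := congrArg Prod.snd (hF x y)
  rw [h1, h1] at h2
  refine h2.trans ?_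
  change _ = ⁅D x, y⁆ + ⁅x, D y⁆
  rw [bracket_skew (D x) y]
  abel

/-- Every family of maps indexed by `X` from generators `Y` extends to an action by derivations. -/
theorem exists_lieAction (d : X → Y → FL Y) : ∃ ρ : LieAction (FL X) (FL Y),
    ∀ x y, ρ.act (gen x) (gen y) = d x y := by
  choose D hD hDgen using fun x => exists_derivation (d x)
  have hact : ∀ u v x, lift D ⁅u, v⁆ x = lift D u (lift D v x) - lift D v (lift D u x) := by
    intro u v x
    rw [isLieHom_lift D u v, AddMonoid.End.lie_apply]
  refine ⟨⟨lift D, hact, fun u => ?_⟩, fun x y => ?_⟩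
  · induction u using induction with
    | gen x => rw [lift_gen]; exact hD x
    | zero =>
      intro x y
      rw [map_zero]
      change (0 : FL Y) = ⁅(0 : FL Y), y⁆ + ⁅x, (0 : FL Y)⁆
      rw [zero_bracket, bracket_zero, add_zero]
    | add u v hu hv =>
      intro x y
      rw [map_add]
      change lift D u ⁅x, y⁆ + lift D v ⁅x, y⁆ =
        ⁅lift D u x + lift D v x, y⁆ + ⁅x, lift D u y + lift D v y⁆
      rw [hu, hv, add_bracket, bracket_add]
      abel
    | neg u hu =>
      intro x y
      rw [map_neg]
      change -(lift D u ⁅x, y⁆) = ⁅-(lift D u x), y⁆ + ⁅x, -(lift D u y)⁆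
      rw [hu, neg_bracket, bracket_neg]
      abel
    | lie u v hu hv =>
      intro x y
      simp only [hact, hu, hv, map_add]
      simp only [sub_eq_add_neg, bracket_add, add_bracket, bracket_neg, neg_bracket]
      abel
  · change lift D (gen x) (gen y) = d x y
    rw [lift_gen, hDgen]

/-- Lazard elimination: the free Lie algebra on `S ⊕ T` retracts onto the sum of the free Lie
algebra on `S` and of the free Lie algebra on the elements `⁅s₁, ⁅s₂, …, ⁅sₙ, t⁆…⁆⁆`. -/
theorem exists_elimination (S T : Type*) : ∃ P : FL (S ⊕ T) →+ FL S × FL (List S × T),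
    (∀ a, P (lift (fun s => gen (Sum.inl s)) a) = (a, 0)) ∧
    ∀ b, P (lift (fun p => adList (p.1.map fun s => gen (Sum.inl s)) (gen (Sum.inr p.2))) b) =
      (0, b) := by
  obtain ⟨ρ, hρ⟩ := exists_lieAction fun (s : S) (p : List S × T) => gen (s :: p.1, p.2)
  let P : FL (S ⊕ T) →+ Semidirect ρ := lift
    (Sum.elim (fun s => (gen s, 0)) fun t => (0, gen ([], t)))
  have hP : IsLieHom P := isLieHom_lift _
  have hl : ∀ s, P (gen (Sum.inl s)) = (gen s, 0) := fun s => lift_gen _ _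
  have hr : ∀ t, P (gen (Sum.inr t)) = (0, gen ([], t)) := fun t => lift_gen _ _
  refine ⟨P, fun a => ?_, fun b => ?_⟩
  · refine hom_ext (L := Semidirect ρ) (F := P.comp (lift _))
      (G := AddMonoidHom.inl (FL S) (FL (List S × T))) (hP.comp (isLieHom_lift _))
      (fun u v => ?_) (fun s => ?_) a
    · rw [Semidirect.lie_def]
      refine Prod.ext rfl ?_
      change (0 : FL (List S × T)) = ⁅(0 : FL (List S × T)), (0 : FL (List S × T))⁆ +
        ρ.act u 0 - ρ.act v 0
      rw [bracket_zero, map_zero, map_zero, add_zero, sub_zero]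
    · rw [AddMonoidHom.comp_apply, lift_gen]
      exact hl s
  · refine hom_ext (L := Semidirect ρ) (F := P.comp (lift _))
      (G := AddMonoidHom.inr (FL S) (FL (List S × T))) (hP.comp (isLieHom_lift _))
      (fun u v => ?_) (fun p => ?_) b
    · rw [Semidirect.lie_def]
      refine Prod.ext (bracket_zero (0 : FL S)).symm ?_
      change ⁅u, v⁆ = ⁅u, v⁆ + ρ.act 0 v - ρ.act 0 u
      rw [map_zero]
      change ⁅u, v⁆ = ⁅u, v⁆ + 0 - 0
      rw [add_zero, sub_zero]
    · obtain ⟨l, t⟩ := p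
      rw [AddMonoidHom.comp_apply, lift_gen]
      change P (adList (l.map fun s => gen (Sum.inl s)) (gen (Sum.inr t))) = (0, gen (l, t))
      induction l with
      | nil => exact hr t
      | cons s l ih =>
        change P ⁅gen (Sum.inl s), adList (l.map fun s => gen (Sum.inl s)) (gen (Sum.inr t))⁆ = _
        rw [hP, ih, hl]
        refine Prod.ext (bracket_zero (gen s)) ?_
        change ⁅(0 : FL (List S × T)), gen (l, t)⁆ + ρ.act (gen s) (gen (l, t)) - ρ.act 0 0 = _
        rw [zero_bracket, map_zero, hρ, zero_add]
        exact sub_zero _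

end FL

end FL

/-! ### Weighted Lie elements -/

section LieSpan

variable {L : Type*} [AntisymLieRing L]

/-- `LieSpan Y n x` says that `x` is an integral linear combination of iterated brackets of total
weight `n` in the weighted elements `Y`. -/
inductive LieSpan (Y : Set (ℕ × L)) : ℕ → L → Prop
  | gen (p : ℕ × L) (hp : p ∈ Y) : LieSpan Y p.1 p.2
  | zero (n : ℕ) : LieSpan Y n 0
  | add {n : ℕ} {x y : L} (hx : LieSpan Y n x) (hy : LieSpan Y n y) : LieSpan Y n (x + y)
  | neg {n : ℕ} {x : L} (hx : LieSpan Y n x) : LieSpan Y n (-x)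
  | lie {m n : ℕ} {x y : L} (hx : LieSpan Y m x) (hy : LieSpan Y n y) : LieSpan Y (m + n) ⁅x, y⁆

namespace LieSpan

variable {S T Y : Set (ℕ × L)} {N : ℕ}

theorem sub {n : ℕ} {x y : L} (hx : LieSpan Y n x) (hy : LieSpan Y n y) : LieSpan Y n (x - y) := by
  rw [sub_eq_add_neg]; exact hx.add hy.neg

theorem mono (h : S ⊆ T) {n : ℕ} {x : L} (hx : LieSpan S n x) : LieSpan T n x := by
  induction hx with
  | gen p hp => exact gen p (h hp)
  | zero => exact zero _
  | add _ _ hx hy => exact hx.add hy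
  | neg _ hx => exact hx.neg
  | lie _ _ hx hy => exact hx.lie hy

/-- Lie elements of weight at most `N` vanish if all generators have larger weight. -/
theorem eq_zero (hY : ∀ p ∈ Y, N < p.1) {n : ℕ} {x : L} (hx : LieSpan Y n x) (hn : n ≤ N) :
    x = 0 := by
  induction hx with
  | gen p hp => exact absurd (hY p hp) (not_lt.mpr hn)
  | zero => rfl
  | add _ _ hx hy => rw [hx hn, hy hn, add_zero]
  | neg _ hx => rw [hx hn, neg_zero]
  | lie _ _ hx _ => rw [hx (by omega), zero_bracket]

theorem mem_of_subset {H : AddSubgroup L} (hH : ∀ u ∈ H, ∀ v ∈ H, ⁅u, v⁆ ∈ H)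
    (hY : ∀ p ∈ Y, p.2 ∈ H) {n : ℕ} {x : L} (hx : LieSpan Y n x) : x ∈ H := by
  induction hx with
  | gen p hp => exact hY p hp
  | zero => exact H.zero_mem
  | add _ _ hx hy => exact H.add_mem hx hy
  | neg _ hx => exact H.neg_mem hx
  | lie _ _ hx hy => exact hH _ hx _ hy

/-- In weights at most `N`, the Lie elements in `T` are stable under brackets with Lie elements in
`S`, if `T` is stable under brackets with elements of `S`. -/
theorem lie_mem (h : ∀ s ∈ S, ∀ t ∈ T, s.1 + t.1 ≤ N → (s.1 + t.1, ⁅s.2, t.2⁆) ∈ T) {m n : ℕ}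
    {a b : L} (ha : LieSpan S m a) (hb : LieSpan T n b) (hN : m + n ≤ N) :
    LieSpan T (m + n) ⁅a, b⁆ := by
  induction ha generalizing n b with
  | gen s hs =>
    induction hb with
    | gen t ht => exact gen _ (h s hs t ht hN)
    | zero n => rw [bracket_zero]; exact zero _
    | add _ _ hx hy => rw [bracket_add]; exact (hx hN).add (hy hN)
    | neg _ hx => rw [bracket_neg]; exact (hx hN).neg
    | @lie n₁ n₂ x y hx hy ihx ihy =>
      rw [bracket_leibniz]
      refine .add ?_ ?_
      · rw [← add_assoc]; exact (ihx (by omega)).lie hy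
      · rw [add_left_comm]; exact hx.lie (ihy (by omega))
  | zero => rw [zero_bracket]; exact zero _
  | add _ _ hx hy => rw [add_bracket]; exact (hx hb hN).add (hy hb hN)
  | neg _ hx => rw [neg_bracket]; exact (hx hb hN).neg
  | @lie m₁ m₂ x y _ _ hx hy =>
    rw [bracket_bracket]
    refine .sub ?_ ?_
    · rw [add_assoc]; exact hx (hy hb (by omega)) (by omega)
    · rw [add_assoc, add_left_comm]; exact hy (hx hb (by omega)) (by omega)

/-- The weighted form of the surjectivity part of Lazard elimination: in weights at most `N`, the Lie
elements in `Y` are sums of Lie elements in `S` and Lie elements in `T'`, provided that `Y` is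
contained in `S ∪ T'` and that `T'` is stable under the operators `⁅s, -⁆` with `s` in `S`. -/
theorem exists_add {T' : Set (ℕ × L)} (hY : ∀ p ∈ Y, p.1 ≤ N → p ∈ S ∨ p ∈ T')
    (h : ∀ s ∈ S, ∀ t ∈ T', s.1 + t.1 ≤ N → (s.1 + t.1, ⁅s.2, t.2⁆) ∈ T') {n : ℕ}
    {x : L} (hx : LieSpan Y n x) (hn : n ≤ N) :
    ∃ a b, LieSpan S n a ∧ LieSpan T' n b ∧ x = a + b := by
  induction hx with
  | gen p hp =>
    rcases hY p hp hn with hp | hp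
    · exact ⟨p.2, 0, gen p hp, zero _, (add_zero _).symm⟩
    · exact ⟨0, p.2, zero _, gen p hp, (zero_add _).symm⟩
  | zero => exact ⟨0, 0, zero _, zero _, (add_zero _).symm⟩
  | add _ _ hx hy =>
    obtain ⟨a, b, ha, hb, rfl⟩ := hx hn
    obtain ⟨a', b', ha', hb', rfl⟩ := hy hn
    exact ⟨a + a', b + b', ha.add ha', hb.add hb', by abel⟩
  | neg _ hx =>
    obtain ⟨a, b, ha, hb, rfl⟩ := hx hn
    exact ⟨-a, -b, ha.neg, hb.neg, by abel⟩
  | @lie n₁ n₂ x y _ _ hx hy =>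
    obtain ⟨a, b, ha, hb, rfl⟩ := hx (by omega)
    obtain ⟨a', b', ha', hb', rfl⟩ := hy (by omega)
    refine ⟨⁅a, a'⁆, ⁅a, b'⁆ + (⁅b, b'⁆ - ⁅a', b⁆), ha.lie ha', (lie_mem h ha hb' hn).add
      ((hb.lie hb').sub ?_), ?_⟩
    · rw [add_comm n₁ n₂] at hn ⊢
      exact lie_mem h ha' hb hn
    · rw [add_bracket, bracket_add, bracket_add, bracket_skew b a']
      abel

end LieSpan

end LieSpan

/-! ### Eliminating Lyndon words in increasing order -/

section Letters

variable {k : ℕ}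

/-- The letters which are left when the Lyndon words in `E` have been eliminated, among the Lyndon
words in `F`: the words outside `E` which are single letters or whose standard left factor is in
`E`. -/
def IsLetter (F E : Finset (List (Fin k))) (q : List (Fin k)) : Prop :=
  q ∈ F ∧ q ∉ E ∧ (2 ≤ q.length → stdLeft q ∈ E)

variable {F E : Finset (List (Fin k))} {N : ℕ} {w q r : List (Fin k)}

theorem isLetter_of_min (hF : ∀ w, w ∈ F ↔ IsLyndon w ∧ w.length ≤ N) (hw : w ∈ F) (hwE : w ∉ E)
    (hlow : ∀ q ∈ F, q < w → q ∈ E) : IsLetter F E w := by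
  refine ⟨hw, hwE, fun hl => hlow _ ?_ (stdLeft_lt hl)⟩
  have h := (hF w).mp hw
  refine (hF _).mpr ⟨h.1.stdLeft hl, ?_⟩
  rw [length_stdLeft hl]
  exact (stdCut_lt w hl).le.trans h.2

theorem IsLetter.insert_of_ne (h : IsLetter F E q) (hqw : q ≠ w) : IsLetter F (insert w E) q :=
  ⟨h.1, by simp [hqw, h.2.1], fun hl => Finset.mem_insert_of_mem (h.2.2 hl)⟩

/-- A letter which is left after the elimination of `w` was a letter before, or is `w r` for such a
letter `r`, with standard factors `w` and `r`. -/
theorem IsLetter.of_insert (hF : ∀ w, w ∈ F ↔ IsLyndon w ∧ w.length ≤ N) (hmax : ∀ e ∈ E, e < w)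
    (hlow : ∀ q ∈ F, q < w → q ∈ E) (h : IsLetter F (insert w E) q) :
    (IsLetter F E q ∧ q ≠ w) ∨
      ∃ r, q = w ++ r ∧ IsLetter F (insert w E) r ∧ stdCut q = w.length := by
  obtain ⟨hqF, hqE, hq⟩ := h
  rw [Finset.mem_insert, not_or] at hqE
  have hlyn := (hF q).mp hqF
  by_cases hl : 2 ≤ q.length
  · rcases Finset.mem_insert.mp (hq hl) with hlw | hlE
    · right
      have hrw : w < stdRight q := hlw ▸ hlyn.1.stdLeft_lt_stdRight hl
      have hlen := congrArg List.length (stdLeft_append_stdRight q)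
      rw [List.length_append] at hlen
      have hrF : stdRight q ∈ F := (hF _).mpr ⟨hlyn.1.stdRight hl, by omega⟩
      refine ⟨stdRight q, by rw [← hlw, stdLeft_append_stdRight], ⟨hrF, ?_, fun hr => ?_⟩, ?_⟩
      · rw [Finset.mem_insert, not_or]
        exact ⟨hrw.ne', fun hE => lt_asymm hrw (hmax _ hE)⟩
      · have hle := stdLeft_stdRight_le hlyn.1 hl hr
        rw [hlw] at hle
        rw [Finset.mem_insert]
        refine hle.eq_or_lt.imp id fun hlt => hlow _ ((hF _).mpr
          ⟨(hlyn.1.stdRight hl).stdLeft hr, ?_⟩) hlt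
        rw [length_stdLeft hr]
        have := stdCut_lt _ hr
        omega
      · rw [← hlw, length_stdLeft hl]
    · exact Or.inl ⟨⟨hqF, hqE.2, fun _ => hlE⟩, hqE.1⟩
  · exact Or.inl ⟨⟨hqF, hqE.2, fun h => absurd h hl⟩, hqE.1⟩

/-- The words `w r` are letters after the elimination of `w`. -/
theorem IsLetter.append (hF : ∀ w, w ∈ F ↔ IsLyndon w ∧ w.length ≤ N) (hmax : ∀ e ∈ E, e < w)
    (hlow : ∀ q ∈ F, q < w → q ∈ E) (hw : w ∈ F) (h : IsLetter F (insert w E) r)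
    (hN : w.length + r.length ≤ N) :
    IsLetter F (insert w E) (w ++ r) ∧ stdCut (w ++ r) = w.length := by
  obtain ⟨hrF, hrE, hr⟩ := h
  rw [Finset.mem_insert, not_or] at hrE
  have hwl := ((hF w).mp hw).1
  have hrl := ((hF r).mp hrF).1
  have hlt : w < r := lt_of_le_of_ne (not_lt.mp fun hlt => hrE.2 (hlow r hrF hlt)) (Ne.symm hrE.1)
  have hcut : stdCut (w ++ r) = w.length := stdCut_append hwl hrl hlt fun hl => by
    rcases Finset.mem_insert.mp (hr hl) with h | h
    · exact h.le
    · exact (hmax _ h).le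
  have hgt : w < w ++ r := lt_of_le_of_ne (le_append w r) fun e => hrl.1 (by simpa using e)
  refine ⟨⟨(hF _).mpr ⟨hwl.append hrl hlt, by rwa [List.length_append]⟩, ?_, fun _ => ?_⟩, hcut⟩
  · rw [Finset.mem_insert, not_or]
    exact ⟨hgt.ne', fun hE => lt_asymm hgt (hmax _ hE)⟩
  · rw [stdLeft, hcut, List.take_left]
    exact Finset.mem_insert_self _ _

theorem length_eq_one_of_isLetter_empty (hF : ∀ w, w ∈ F ↔ IsLyndon w ∧ w.length ≤ N)
    (h : IsLetter F ∅ q) : q.length = 1 := by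
  have h1 := List.length_pos_iff.mpr ((hF q).mp h.1).1.1
  have h2 : ¬ 2 ≤ q.length := fun hl => Finset.notMem_empty _ (h.2.2 hl)
  omega

theorem isLetter_singleton (hF : ∀ w, w ∈ F ↔ IsLyndon w ∧ w.length ≤ N) (hN : 1 ≤ N) (a : Fin k) :
    IsLetter F ∅ [a] :=
  ⟨(hF _).mpr ⟨isLyndon_singleton a, hN⟩, Finset.notMem_empty _, fun h => by simp at h⟩

theorem exists_finset_lyndon (k N : ℕ) :
    ∃ F : Finset (List (Fin k)), ∀ w, w ∈ F ↔ IsLyndon w ∧ w.length ≤ N :=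
  ⟨((List.finite_length_le (Fin k) N).subset fun _ h => h.2 :
    {w : List (Fin k) | IsLyndon w ∧ w.length ≤ N}.Finite).toFinset, fun w => by simp⟩

end Letters

/-! ### Standard bracketings over a coloured alphabet -/

section Coloured

variable {k : ℕ} {X : Type*} (c : X → Fin k)

/-- The value in the free Lie algebra on `X` of the standard bracketing of a word in `X`, formed by
means of the colours of its letters; `0` for the empty word. -/
noncomputable def stdElement (x : List X) : FL X :=
  if h : x = [] then 0 else evalMonomial FL.gen (stdMonomial c x h)

theorem stdElement_singleton (a : X) : stdElement c [a] = FL.gen a := by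
  rw [stdElement, dif_neg (by simp), stdMonomial]
  rfl

theorem stdElement_append {y z : List X} (hy : y ≠ []) (hz : z ≠ [])
    (h : stdCut ((y ++ z).map c) = y.length) :
    stdElement c (y ++ z) = ⁅stdElement c y, stdElement c z⁆ := by
  rw [stdElement, dif_neg (by simp [hy]), stdElement, dif_neg hy, stdElement, dif_neg hz]
  have key : ∀ (x : List X) (hx : x ≠ []) (p : ℕ), 2 ≤ x.length → stdCut (x.map c) = p →
      ∀ (h1 : x.take p ≠ []) (h2 : x.drop p ≠ []),
      stdMonomial c x hx = stdMonomial c (x.take p) h1 * stdMonomial c (x.drop p) h2 := by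
    intro x hx p hl hp h1 h2
    subst hp
    match x, hx, hl with
    | a :: b :: l, _, _ => rw [stdMonomial]
  have hl : 2 ≤ (y ++ z).length := by
    have := List.length_pos_iff.mpr hy
    have := List.length_pos_iff.mpr hz
    rw [List.length_append]; omega
  rw [key (y ++ z) (by simp [hy]) y.length hl h (by simpa using hy) (by simpa using hz)]
  simp only [List.take_left, List.drop_left]
  rfl

/-- The words in `X` with colour word `w`. -/
abbrev ColouredWord (w : List (Fin k)) : Type _ := {x : List X // x.map c = w}

/-- The homomorphism from the free Lie algebra on the words with colour word `w` to the free Lie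
algebra on `X` given by the standard bracketing. -/
noncomputable def colouredLift (w : List (Fin k)) : FL (ColouredWord c w) →+ FL X :=
  FL.lift fun x => stdElement c x.1

variable {F E : Finset (List (Fin k))} {N : ℕ} {w : List (Fin k)}

/-- The words in `X` whose colour words are letters after the elimination of `E`. -/
abbrev LetterWord (F E : Finset (List (Fin k))) : Type _ := {x : List X // IsLetter F E (x.map c)}

/-- The standard bracketing of a letter after the elimination of `w` is an iterated bracket
`⁅s₁, ⁅s₂, …, ⁅sₙ, t⁆…⁆⁆`, with `sᵢ` of colour `w` and `t` another letter before the elimination. -/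
theorem exists_adList_eq (hF : ∀ w, w ∈ F ↔ IsLyndon w ∧ w.length ≤ N) (hmax : ∀ e ∈ E, e < w)
    (hlow : ∀ q ∈ F, q < w → q ∈ E) (hw : w ∈ F) (x : List X)
    (hx : IsLetter F (insert w E) (x.map c)) :
    ∃ (l : List (ColouredWord c w)) (t : {y : LetterWord c F E // y.1.map c ≠ w}),
      x = (l.map Subtype.val).flatten ++ t.1.1 ∧
      stdElement c x = adList (l.map fun s => stdElement c s.1) (stdElement c t.1.1) := by
  induction hn : x.length using Nat.strong_induction_on generalizing x with
  | _ n ih =>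
    rcases hx.of_insert hF hmax hlow with ⟨h1, h2⟩ | ⟨r, hr, hrl, hcut⟩
    · exact ⟨[], ⟨⟨x, h1⟩, h2⟩, rfl, rfl⟩
    · have hw0 : w ≠ [] := ((hF w).mp hw).1.1
      have hr0 : r ≠ [] := ((hF r).mp hrl.1).1.1
      obtain ⟨y, z, rfl, rfl, rfl⟩ := List.map_eq_append_iff.mp hr
      have hy : y ≠ [] := by rintro rfl; exact hw0 rfl
      have hz : z ≠ [] := by rintro rfl; exact hr0 rfl
      have hlen : z.length < n := by
        rw [← hn, List.length_append]
        have := List.length_pos_iff.mpr hy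
        omega
      obtain ⟨l, t, hzt, ht⟩ := ih _ hlen z hrl rfl
      refine ⟨⟨y, rfl⟩ :: l, t, ?_, ?_⟩
      · rw [List.map_cons, List.flatten_cons, List.append_assoc, ← hzt]
      · rw [stdElement_append c hy hz (hcut.trans (by simp)), ht]
        rfl

/-- One step of the elimination, for the injectivity: elements of the free Lie algebras on the words
of colour `w` and on the letters after the elimination of `w` come from one element of the free Lie
algebra on the letters before it, which vanishes only if both of them do. -/
theorem eq_zero_of_elimination (hF : ∀ w, w ∈ F ↔ IsLyndon w ∧ w.length ≤ N)
    (hmax : ∀ e ∈ E, e < w) (hlow : ∀ q ∈ F, q < w → q ∈ E) (hw : w ∈ F)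
    (a : FL (ColouredWord c w)) (b : FL (LetterWord c F (insert w E))) :
    ∃ b' : FL (LetterWord c F E),
      FL.lift (fun y => stdElement c y.1) b' =
        colouredLift c w a + FL.lift (fun y => stdElement c y.1) b ∧
      (b' = 0 → a = 0 ∧ b = 0) := by
  classical
  choose l t hσ hstd using fun x : LetterWord c F (insert w E) =>
    exists_adList_eq c hF hmax hlow hw x.1 x.2
  have hwl : IsLetter F E w :=
    isLetter_of_min hF hw (fun h => lt_irrefl w (hmax w h)) hlow
  obtain ⟨P, hPl, hPr⟩ := FL.exists_elimination (ColouredWord c w)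
    {y : LetterWord c F E // y.1.map c ≠ w}
  -- The letters before the elimination are the words with colour word `w` and the remaining ones.
  let f : FL (ColouredWord c w ⊕ {y : LetterWord c F E // y.1.map c ≠ w}) →+
      FL (LetterWord c F E) :=
    FL.lift (Sum.elim (fun s => FL.gen ⟨s.1, s.2.symm ▸ hwl⟩) fun t => FL.gen t.1)
  let g : FL (LetterWord c F E) →+
      FL (ColouredWord c w ⊕ {y : LetterWord c F E // y.1.map c ≠ w}) :=
    FL.lift fun y => if h : y.1.map c = w then FL.gen (Sum.inl ⟨y.1, h⟩)
      else FL.gen (Sum.inr ⟨y, h⟩)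
  have hf : IsLieHom f := FL.isLieHom_lift _
  have hg : IsLieHom g := FL.isLieHom_lift _
  have hfl : ∀ s, f (FL.gen (Sum.inl s)) = FL.gen ⟨s.1, s.2.symm ▸ hwl⟩ := fun s => FL.lift_gen _ _
  have hfr : ∀ t, f (FL.gen (Sum.inr t)) = FL.gen t.1 := fun t => FL.lift_gen _ _
  have hgf : ∀ z, g (f z) = z := by
    refine FL.hom_ext (F := g.comp f) (hg.comp hf) isLieHom_id fun z => ?_
    rcases z with s | t
    · rw [AddMonoidHom.comp_apply, hfl]
      exact (FL.lift_gen _ _).trans (dif_pos s.2)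
    · rw [AddMonoidHom.comp_apply, hfr]
      exact (FL.lift_gen _ _).trans (dif_neg t.2)
  let ι : FL (List (ColouredWord c w) × {y : LetterWord c F E // y.1.map c ≠ w}) →+
      FL (ColouredWord c w ⊕ {y : LetterWord c F E // y.1.map c ≠ w}) :=
    FL.lift fun p => adList (p.1.map fun s => FL.gen (Sum.inl s)) (FL.gen (Sum.inr p.2))
  let σ : FL (LetterWord c F (insert w E)) →+
      FL (List (ColouredWord c w) × {y : LetterWord c F E // y.1.map c ≠ w}) :=
    FL.lift fun x => FL.gen (l x, t x)
  -- A left inverse of `σ`, which concatenates, and kills the generators which do not give a letter.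
  let τ : FL (List (ColouredWord c w) × {y : LetterWord c F E // y.1.map c ≠ w}) →+
      FL (LetterWord c F (insert w E)) :=
    FL.lift fun p =>
      if h : IsLetter F (insert w E) (((p.1.map Subtype.val).flatten ++ p.2.1.1).map c)
      then FL.gen ⟨_, h⟩ else 0
  have hτσ : ∀ z, τ (σ z) = z := by
    refine FL.hom_ext (F := τ.comp σ) ((FL.isLieHom_lift _).comp (FL.isLieHom_lift _)) isLieHom_id
      fun x => ?_
    have h1 : σ (FL.gen x) = FL.gen (l x, t x) := FL.lift_gen _ _
    rw [AddMonoidHom.comp_apply, h1, AddMonoidHom.id_apply]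
    refine (FL.lift_gen _ _).trans ?_
    have h2 := x.2
    rw [hσ x] at h2
    rw [dif_pos h2]
    exact congrArg FL.gen (Subtype.ext (hσ x).symm)
  let jl : FL (ColouredWord c w) →+
      FL (ColouredWord c w ⊕ {y : LetterWord c F E // y.1.map c ≠ w}) :=
    FL.lift fun s => FL.gen (Sum.inl s)
  let φ : FL (LetterWord c F E) →+ FL X := FL.lift fun y => stdElement c y.1
  have hφ : IsLieHom φ := FL.isLieHom_lift _
  have hφf : IsLieHom (φ.comp f) := hφ.comp hf
  have hφl : ∀ s, φ.comp f (FL.gen (Sum.inl s)) = stdElement c s.1 := fun s => by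
    rw [AddMonoidHom.comp_apply, hfl]; exact FL.lift_gen _ _
  have hφr : ∀ t, φ.comp f (FL.gen (Sum.inr t)) = stdElement c t.1.1 := fun t => by
    rw [AddMonoidHom.comp_apply, hfr]; exact FL.lift_gen _ _
  have hι : IsLieHom ι := FL.isLieHom_lift _
  have hσl : IsLieHom σ := FL.isLieHom_lift _
  have hσg : ∀ x, σ (FL.gen x) = FL.gen (l x, t x) := fun x => FL.lift_gen _ _
  have hιg : ∀ p, ι (FL.gen p) =
      adList (p.1.map fun s => FL.gen (Sum.inl s)) (FL.gen (Sum.inr p.2)) :=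
    fun p => FL.lift_gen _ _
  refine ⟨f (jl a + ι (σ b)), ?_, fun h => ?_⟩
  · have e1 : ∀ a, φ.comp f (jl a) = colouredLift c w a :=
      FL.hom_ext (F := (φ.comp f).comp jl) (hφf.comp (FL.isLieHom_lift _)) (FL.isLieHom_lift _)
        fun s => by
          rw [AddMonoidHom.comp_apply, FL.lift_gen, hφl, colouredLift, FL.lift_gen]
    have e2 : ∀ b, φ.comp f (ι (σ b)) = FL.lift (fun y => stdElement c y.1) b :=
      FL.hom_ext (F := (φ.comp f).comp (ι.comp σ))
        (hφf.comp (hι.comp hσl)) (FL.isLieHom_lift _)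
        fun x => by
          change φ.comp f (ι (σ (FL.gen x))) = _
          rw [hσg, hιg, hφf.map_adList, FL.lift_gen, hstd x, hφr, List.map_map]
          exact congrArg (fun l => adList l _) (List.map_congr_left fun s _ => hφl s)
    change φ.comp f (jl a + ι (σ b)) = _
    rw [map_add, e1, e2]
  · have h1 := congrArg (fun z => P (g z)) h
    simp only [hgf, map_zero] at h1
    rw [map_add, hPl, hPr, Prod.ext_iff] at h1
    have ha : a + 0 = 0 := h1.1
    have hb : 0 + σ b = 0 := h1.2
    rw [add_zero] at ha
    rw [zero_add] at hb
    refine ⟨ha, ?_⟩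
    rw [← hτσ b, hb, map_zero]

/-- The maps from the free Lie algebras attached to the eliminated Lyndon words and to the remaining
letters have an injective sum. -/
theorem eq_zero_of_sum_add_eq_zero (hF : ∀ w, w ∈ F ↔ IsLyndon w ∧ w.length ≤ N) (hN : 1 ≤ N)
    (E : Finset (List (Fin k))) (hEF : E ⊆ F) (hE : ∀ e ∈ E, ∀ q ∈ F, q < e → q ∈ E)
    (a : ∀ w, FL (ColouredWord c w)) (b : FL (LetterWord c F E))
    (h : ∑ w ∈ E, colouredLift c w (a w) + FL.lift (fun y => stdElement c y.1) b = 0) :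
    (∀ w ∈ E, a w = 0) ∧ b = 0 := by
  induction E using Finset.induction_on_max with
  | empty =>
    refine ⟨fun w hw => absurd hw (Finset.notMem_empty w), ?_⟩
    rw [Finset.sum_empty, zero_add] at h
    let r : FL X →+ FL (LetterWord c F ∅) :=
      FL.lift fun x => FL.gen ⟨[x], isLetter_singleton hF hN (c x)⟩
    have hr : ∀ b, r (FL.lift (fun y : LetterWord c F ∅ => stdElement c y.1) b) = b := by
      refine FL.hom_ext (F := r.comp (FL.lift _)) ((FL.isLieHom_lift _).comp (FL.isLieHom_lift _))
        isLieHom_id fun y => ?_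
      obtain ⟨y, hy⟩ := y
      have hlen := length_eq_one_of_isLetter_empty hF hy
      rw [List.length_map] at hlen
      obtain ⟨x, rfl⟩ := List.length_eq_one_iff.mp hlen
      rw [AddMonoidHom.comp_apply, FL.lift_gen, stdElement_singleton]
      exact FL.lift_gen _ _
    rw [← hr b, h, map_zero]
  | insert w E hmax ih =>
    have hwE : w ∉ E := fun hw => lt_irrefl w (hmax w hw)
    have hlow : ∀ q ∈ F, q < w → q ∈ E := fun q hq hlt =>
      (Finset.mem_insert.mp (hE w (Finset.mem_insert_self w E) q hq hlt)).resolve_left hlt.ne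
    have hw : w ∈ F := hEF (Finset.mem_insert_self w E)
    obtain ⟨b', hb', hb0⟩ := eq_zero_of_elimination c hF hmax hlow hw (a w) b
    rw [Finset.sum_insert hwE, add_comm (colouredLift c w (a w)), add_assoc, ← hb'] at h
    obtain ⟨h1, h2⟩ := ih ((Finset.subset_insert w E).trans hEF)
      (fun e he q hq hlt => hlow q hq (hlt.trans (hmax e he))) b' h
    obtain ⟨h3, h4⟩ := hb0 h2
    refine ⟨fun u hu => ?_, h4⟩
    rcases Finset.mem_insert.mp hu with rfl | hu
    · exact h3
    · exact h1 u hu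

/-- The sum of the maps `colouredLift c w`, over Lyndon words `w`, is injective. -/
theorem eq_zero_of_sum_colouredLift_eq_zero (G : Finset (List (Fin k))) (hG : ∀ w ∈ G, IsLyndon w)
    (a : ∀ w, FL (ColouredWord c w)) (h : ∑ w ∈ G, colouredLift c w (a w) = 0) :
    ∀ w ∈ G, a w = 0 := by
  classical
  obtain ⟨F, hF⟩ := exists_finset_lyndon k (G.sup List.length + 1)
  have hGF : G ⊆ F := fun w hw =>
    (hF w).mpr ⟨hG w hw, (Finset.le_sup (f := List.length) hw).trans (Nat.le_succ _)⟩
  let a' : ∀ w, FL (ColouredWord c w) := fun w => if w ∈ G then a w else 0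
  have ha' : ∀ w ∈ G, a' w = a w := fun w hw => if_pos hw
  have hsum : ∑ w ∈ F, colouredLift c w (a' w) = 0 := by
    rw [← Finset.sum_subset hGF fun w _ hw => ?_, ← h]
    · exact Finset.sum_congr rfl fun w hw => by rw [ha' w hw]
    · change colouredLift c w (if w ∈ G then a w else 0) = 0
      rw [if_neg hw, map_zero]
  intro w hw
  rw [← ha' w hw]
  refine (eq_zero_of_sum_add_eq_zero c hF (Nat.le_add_left 1 _) F (Finset.Subset.refl F)
    (fun _ _ q hq _ => hq) a' 0 ?_).1 w (hGF hw)
  rw [hsum, map_zero, add_zero]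

/-- The standard bracketings of the words in `X` whose colour words are letters after the
elimination of `E`, weighted by their lengths. -/
def weightedLetters (F E : Finset (List (Fin k))) : Set (ℕ × FL X) :=
  {p | ∃ x : List X, IsLetter F E (x.map c) ∧ p = (x.length, stdElement c x)}

/-- In weights at most `N`, every Lie element is a sum of values of the maps attached to Lyndon words
and a Lie element in the remaining letters. -/
theorem exists_sum_add_lieSpan (hF : ∀ w, w ∈ F ↔ IsLyndon w ∧ w.length ≤ N)
    {R : AddSubgroup (FL X)} (hR : ∀ w, IsLyndon w → (colouredLift c w).range ≤ R)
    (E : Finset (List (Fin k))) (hEF : E ⊆ F) (hE : ∀ e ∈ E, ∀ q ∈ F, q < e → q ∈ E) {n : ℕ}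
    {x : FL X} (hx : LieSpan (weightedLetters c F ∅) n x) (hn : n ≤ N) :
    ∃ r ∈ R, ∃ b, LieSpan (weightedLetters c F E) n b ∧ x = r + b := by
  induction E using Finset.induction_on_max with
  | empty => exact ⟨0, R.zero_mem, x, hx, (zero_add x).symm⟩
  | insert w E hmax ih =>
    have hlow : ∀ q ∈ F, q < w → q ∈ E := fun q hq hlt =>
      (Finset.mem_insert.mp (hE w (Finset.mem_insert_self w E) q hq hlt)).resolve_left hlt.ne
    have hw : w ∈ F := hEF (Finset.mem_insert_self w E)
    have hwl := ((hF w).mp hw).1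
    obtain ⟨r, hr, b, hb, rfl⟩ := ih ((Finset.subset_insert w E).trans hEF)
      (fun e he q hq hlt => hlow q hq (hlt.trans (hmax e he)))
    let S : Set (ℕ × FL X) := {p | ∃ y : List X, y.map c = w ∧ p = (y.length, stdElement c y)}
    have hY : ∀ p ∈ weightedLetters c F E, p.1 ≤ N →
        p ∈ S ∨ p ∈ weightedLetters c F (insert w E) := by
      rintro _ ⟨y, hy, rfl⟩ _
      by_cases hyw : y.map c = w
      · exact Or.inl ⟨y, hyw, rfl⟩
      · exact Or.inr ⟨y, hy.insert_of_ne hyw, rfl⟩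
    have hS : ∀ s ∈ S, ∀ t ∈ weightedLetters c F (insert w E), s.1 + t.1 ≤ N →
        (s.1 + t.1, ⁅s.2, t.2⁆) ∈ weightedLetters c F (insert w E) := by
      rintro _ ⟨y, hy, rfl⟩ _ ⟨z, hz, rfl⟩ hlen
      subst hy
      have hy0 : y ≠ [] := by rintro rfl; exact hwl.1 rfl
      have hz0 : z ≠ [] := by rintro rfl; exact ((hF _).mp hz.1).1.1 rfl
      obtain ⟨h1, h2⟩ := hz.append hF hmax hlow hw (by simpa using hlen)
      rw [← List.map_append] at h1 h2
      refine ⟨y ++ z, h1, Prod.ext (List.length_append).symm ?_⟩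
      rw [List.length_map] at h2
      exact (stdElement_append c hy0 hz0 h2).symm
    obtain ⟨a, b', ha, hb', rfl⟩ := LieSpan.exists_add hY hS hb hn
    refine ⟨r + a, R.add_mem hr (hR w hwl ?_), b', hb', (add_assoc r a b').symm⟩
    refine LieSpan.mem_of_subset ?_ ?_ ha
    · rintro _ ⟨u, rfl⟩ _ ⟨v, rfl⟩
      exact ⟨⁅u, v⁆, FL.isLieHom_lift _ u v⟩
    · rintro _ ⟨y, hy, rfl⟩
      exact ⟨FL.gen ⟨y, hy⟩, FL.lift_gen _ _⟩

/-- The sum of the maps `colouredLift c w`, over Lyndon words `w`, is surjective. -/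
theorem mem_iSup_range_colouredLift (x : FL X) :
    x ∈ ⨆ w : {w : List (Fin k) // IsLyndon w}, (colouredLift c w.1).range := by
  set R := ⨆ w : {w : List (Fin k) // IsLyndon w}, (colouredLift c w.1).range
  have hR : ∀ w, IsLyndon w → (colouredLift c w).range ≤ R := fun w hw =>
    le_iSup (fun w : {w : List (Fin k) // IsLyndon w} => (colouredLift c w.1).range) ⟨w, hw⟩
  let G : Set (ℕ × FL X) := Set.range fun x => (1, FL.gen x)
  have hG : {y | ∃ n, LieSpan G n y} ⊆ R := by
    rintro y ⟨n, hy⟩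
    obtain ⟨F, hF⟩ := exists_finset_lyndon k (n + 1)
    have hy' : LieSpan (weightedLetters c F ∅) n y := by
      refine hy.mono ?_
      rintro _ ⟨x, rfl⟩
      exact ⟨[x], isLetter_singleton hF (Nat.le_add_left 1 n) (c x),
        Prod.ext rfl (stdElement_singleton c x).symm⟩
    obtain ⟨r, hr, b, hb, rfl⟩ := exists_sum_add_lieSpan c hF hR F (Finset.Subset.refl F)
      (fun _ _ q hq _ => hq) hy' n.le_succ
    have hb0 : b = 0 := hb.eq_zero (N := n + 1) (by
      rintro _ ⟨z, hz, rfl⟩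
      exact absurd hz.1 hz.2.1) n.le_succ
    rw [hb0, add_zero]
    exact hr
  refine (AddSubgroup.closure_le R).mpr hG ?_
  induction x using FL.induction with
  | gen x =>
    exact AddSubgroup.subset_closure ⟨1, LieSpan.gen (1, FL.gen x) (Set.mem_range_self x)⟩
  | zero => exact AddSubgroup.zero_mem _
  | add x y hx hy => exact AddSubgroup.add_mem _ hx hy
  | neg x hx => exact AddSubgroup.neg_mem _ hx
  | lie x y hx hy =>
    induction hx, hy using AddSubgroup.closure_induction₂ with
    | mem x y hx hy =>
      obtain ⟨m, hx⟩ := hx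
      obtain ⟨n, hy⟩ := hy
      exact AddSubgroup.subset_closure ⟨m + n, hx.lie hy⟩
    | zero_left x _ => rw [zero_bracket]; exact AddSubgroup.zero_mem _
    | zero_right x _ => rw [bracket_zero]; exact AddSubgroup.zero_mem _
    | add_left x y z _ _ _ h1 h2 => rw [add_bracket]; exact AddSubgroup.add_mem _ h1 h2
    | add_right x y z _ _ _ h1 h2 => rw [bracket_add]; exact AddSubgroup.add_mem _ h1 h2
    | neg_left x y _ _ h => rw [neg_bracket]; exact AddSubgroup.neg_mem _ h
    | neg_right x y _ _ h => rw [bracket_neg]; exact AddSubgroup.neg_mem _ h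

end Coloured

open scoped DirectSum TensorProduct

/-! ### Passage from bases to modules -/

section Basis

theorem FreeLie.hom_ext {V L : Type*} [AddCommGroup V] [AntisymLieRing L] {F G : FreeLie V →+ L}
    (hF : IsLieHom F) (hG : IsLieHom G) (h : ∀ v, F (FreeLie.of V v) = G (FreeLie.of V v))
    (x : FreeLie V) : F x = G x := by
  induction x using FreeLie.induction with
  | of v => exact h v
  | zero => rw [map_zero, map_zero]
  | add x y hx hy => rw [map_add, map_add, hx, hy]
  | neg x hx => rw [map_neg, map_neg, hx]
  | lie x y hx hy => rw [hF, hG, hx, hy]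

/-- The free Lie algebra on a free abelian group is the free Lie algebra on a basis. -/
theorem FL.bijective_lift_basis {V X : Type*} [AddCommGroup V] [Module ℤ V]
    (b : Module.Basis X ℤ V) :
    Function.Bijective (FL.lift fun x => FreeLie.of V (b x) : FL X →+ FreeLie V) := by
  let φ : FL X →+ FreeLie V := FL.lift fun x => FreeLie.of V (b x)
  let r : FreeLie V →+ FL X :=
    (FreeLie.lift ((FreeLie.of (X →₀ ℤ)).comp b.repr.toAddMonoidHom)).toAddMonoidHom
  have hφ : IsLieHom φ := FL.isLieHom_lift _
  have hr : IsLieHom r := (FreeLie.lift _).map_lie'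
  have hφg : ∀ x, φ (FL.gen x) = FreeLie.of V (b x) := fun x => FL.lift_gen _ x
  have hro : ∀ v, r (FreeLie.of V v) = FreeLie.of _ (b.repr v) := fun v => FreeLie.lift_of _ v
  have hφo : ∀ f : X →₀ ℤ, φ (FreeLie.of _ f) = FreeLie.of V (b.repr.symm f) := by
    intro f
    induction f using Finsupp.induction_linear with
    | zero => simp
    | add f g hf hg => simp only [map_add, hf, hg]
    | single a n =>
      have h : Finsupp.single a n = n • Finsupp.single a (1 : ℤ) := by simp
      rw [h, map_zsmul, map_zsmul, map_zsmul, map_zsmul, b.repr_symm_single_one]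
      exact congrArg (n • ·) (hφg a)
  refine Function.bijective_iff_has_inverse.mpr ⟨r, fun x => ?_, fun x => ?_⟩
  · refine FL.hom_ext (F := r.comp φ) (hr.comp hφ) isLieHom_id (fun x => ?_) x
    rw [AddMonoidHom.comp_apply, hφg, hro, b.repr_self]
    rfl
  · refine FreeLie.hom_ext (F := φ.comp r) (hφ.comp hr) isLieHom_id (fun v => ?_) x
    rw [AddMonoidHom.comp_apply, hro, hφo, LinearEquiv.symm_apply_apply]
    rfl

theorem dfinsupp_basis_apply {ι : Type*} [DecidableEq ι] {V : ι → Type*} [∀ i, AddCommGroup (V i)]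
    {X : ι → Type*} (b : ∀ i, Module.Basis (X i) ℤ (V i)) (x : Σ i, X i) :
    DFinsupp.basis b x = DirectSum.of V x.1 (b x.1 x.2) := by
  obtain ⟨i, x⟩ := x
  rw [Module.Basis.apply_eq_iff]
  ext ⟨j, y⟩
  change (b j).repr (DirectSum.of V i (b i x) j) y = _
  by_cases h : j = i
  · subst h
    rw [DirectSum.of_eq_same, Module.Basis.repr_self]
    by_cases hxy : x = y
    · subst hxy; simp
    · rw [Finsupp.single_eq_of_ne (Ne.symm hxy), Finsupp.single_eq_of_ne]
      simpa using Ne.symm hxy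
  · rw [DirectSum.of_eq_of_ne _ _ _ h, map_zero, Finsupp.single_eq_of_ne]
    · rfl
    · simp [h]

end Basis

section Monomials

theorem IsLieHom.map_evalMonomial {A L M : Type*} [AntisymLieRing L] [AntisymLieRing M] {F : L →+ M}
    (hF : IsLieHom F) (v : A → L) (t : FreeMagma A) :
    F (evalMonomial v t) = evalMonomial (fun a => F (v a)) t := by
  induction t with
  | ih1 a => rfl
  | ih2 s t hs ht =>
    change F ⁅evalMonomial v s, evalMonomial v t⁆ = ⁅_, _⁆
    rw [hF, hs, ht]

theorem evalMonomial_stdMonomial_map {k : ℕ} {A B L : Type*} [AntisymLieRing L] (c : B → Fin k)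
    (g : A → B) (v : B → L) (x : List A) (hx : x ≠ []) (hx' : x.map g ≠ []) :
    evalMonomial v (stdMonomial c (x.map g) hx') =
      evalMonomial (fun a => v (g a)) (stdMonomial (fun a => c (g a)) x hx) := by
  induction hn : x.length using Nat.strong_induction_on generalizing x with
  | _ n ih =>
    match x, hx, hx' with
    | [a], _, _ => simp only [List.map_cons, List.map_nil, stdMonomial]; rfl
    | a :: b :: l, _, _ =>
      have hmap : ((a :: b :: l).map g).map c = (a :: b :: l).map fun a => c (g a) := by
        rw [List.map_map]; rfl
      have h1 := stdCut_pos ((a :: b :: l).map fun a => c (g a))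
      have h2 := stdCut_lt ((a :: b :: l).map fun a => c (g a)) (by simp)
      rw [List.length_map] at h2
      have key : ∀ (y : List B) (hy : y ≠ []), y = (a :: b :: l).map g →
          evalMonomial v (stdMonomial c y hy) = evalMonomial (fun a => v (g a))
            (stdMonomial (fun a => c (g a)) (a :: b :: l) (by simp)) := by
        intro y hy hyx
        match y, hy, hyx with
        | a' :: b' :: l', hy, hyx =>
          rw [stdMonomial, stdMonomial]
          change ⁅_, _⁆ = ⁅_, _⁆
          congr 1
          · simp only [hyx, hmap, ← List.map_take]
            refine ih _ ?_ _ _ _ rfl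
            rw [← hn, List.length_take]; omega
          · simp only [hyx, hmap, ← List.map_drop]
            refine ih _ ?_ _ _ _ rfl
            rw [← hn, List.length_drop]; omega
      exact key _ _ rfl

end Monomials

section Labels

variable {k : ℕ} {m : Fin k → ℕ} (u : LyndonWord m)

theorem LyndonWord.map_fst_labels : u.labels.map Sigma.fst = u.word := by
  rw [LyndonWord.labels, List.map_ofFn]
  exact List.ofFn_getElem

theorem LyndonWord.mem_labels (p : Σ i, Fin (m i)) : p ∈ u.labels := by
  rw [LyndonWord.labels, List.mem_ofFn]
  exact u.label_bijective.2 p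

/-- Filling the positions of a Lyndon word: families indexed by the labels are words with the given
colour word. -/
noncomputable def LyndonWord.fill {X : Fin k → Type*} :
    (∀ p : Σ i, Fin (m i), X p.1) ≃ ColouredWord (Sigma.fst : (Σ i, X i) → Fin k) u.word :=
  Equiv.ofBijective
    (fun f => ⟨u.labels.map fun p => ⟨p.1, f p⟩, by
      rw [List.map_map]; exact u.map_fst_labels⟩) <| by
    refine ⟨fun f g h => funext fun p => ?_, fun x => ?_⟩
    · have h1 := List.map_inj_left.mp (congrArg Subtype.val h) p (u.mem_labels p)
      simpa using h1
    · obtain ⟨x, hx⟩ := x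
      have hlen : x.length = u.word.length := by rw [← hx, List.length_map]
      have hex : ∀ p : Σ i, Fin (m i), ∃ y : X p.1, ∀ n : Fin u.word.length, u.label n = p →
          x[(n : ℕ)]'(n.2.trans_eq hlen.symm) = ⟨p.1, y⟩ := by
        intro p
        obtain ⟨n, rfl⟩ := u.label_bijective.2 p
        have h1 : (x[(n : ℕ)]'(n.2.trans_eq hlen.symm)).1 = (u.label n).1 := by
          change _ = u.word[(n : ℕ)]
          simp [← hx]
        refine ⟨h1 ▸ (x[(n : ℕ)]'(n.2.trans_eq hlen.symm)).2, fun n' hn' => ?_⟩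
        rw [u.label_injective hn']
        refine Sigma.ext h1 ?_
        exact (eqRec_heq h1 _).symm
      choose f hf using hex
      refine ⟨f, Subtype.ext ?_⟩
      change u.labels.map (fun p => (⟨p.1, f p⟩ : Σ i, X i)) = x
      refine List.ext_getElem (by simp [LyndonWord.labels, hlen]) fun n h1 h2 => ?_
      rw [hf (u.label ⟨n, h2.trans_eq hlen⟩) ⟨n, h2.trans_eq hlen⟩ rfl]
      simp [LyndonWord.labels]

theorem LyndonWord.coe_fill {X : Fin k → Type*} (f : ∀ p : Σ i, Fin (m i), X p.1) :
    (u.fill f : List (Σ i, X i)) = u.labels.map fun p => ⟨p.1, f p⟩ := rfl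

end Labels

/-- The index of a Lyndon word. -/
def lyndonIndex {k : ℕ} (w : List (Fin k)) (h : IsLyndon w) : Σ m : Fin k → ℕ, LyndonWord m :=
  ⟨fun i => w.count i, ⟨w, h, fun _ => rfl⟩⟩

theorem lyndonIndex_word {k : ℕ} (u : Σ m : Fin k → ℕ, LyndonWord m) :
    lyndonIndex u.2.word u.2.isLyndon = u := by
  obtain ⟨m, w, h, hm⟩ := u
  obtain rfl : (fun i => w.count i) = m := funext hm
  rfl

theorem word_injective {k : ℕ} :
    Function.Injective fun u : Σ m : Fin k → ℕ, LyndonWord m => u.2.word := by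
  intro u v h
  rw [← lyndonIndex_word u, ← lyndonIndex_word v]
  congr 1

section Transfer

variable {k : ℕ} {V : Fin k → Type*} [∀ i, AddCommGroup (V i)] {X : Fin k → Type*}
  (b : ∀ i, Module.Basis (X i) ℤ (V i))

/-- The basis of `V_1^{⊗ m_1} ⊗ ⋯ ⊗ V_k^{⊗ m_k}` made of pure tensors of basis elements, indexed by
the words in the basis elements with colour word `u`. -/
noncomputable def mixedBasis {m : Fin k → ℕ} (u : LyndonWord m) :
    Module.Basis (ColouredWord (Sigma.fst : (Σ i, X i) → Fin k) u.word) ℤ (MixedTensorPower V m) :=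
  (Basis.piTensorProduct fun p : Σ i, Fin (m i) => b p.1).reindex u.fill

/-- The isomorphism from the free Lie algebra on the basis `mixedBasis`. -/
noncomputable def sourceMap {m : Fin k → ℕ} (u : LyndonWord m) :
    FL (ColouredWord (Sigma.fst : (Σ i, X i) → Fin k) u.word) →+ FreeLie (MixedTensorPower V m) :=
  FL.lift fun x => FreeLie.of _ (mixedBasis b u x)

theorem bijective_sourceMap {m : Fin k → ℕ} (u : LyndonWord m) :
    Function.Bijective (sourceMap b u) := FL.bijective_lift_basis (mixedBasis b u)

/-- The isomorphism from the free Lie algebra on a basis of `V_1 ⊕ ⋯ ⊕ V_k`. -/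
noncomputable def targetMap : FL (Σ i, X i) →+ FreeLie (⨁ i, V i) :=
  FL.lift fun x => FreeLie.of _ (DirectSum.of V x.1 (b x.1 x.2))

theorem bijective_targetMap : Function.Bijective (targetMap b) := by
  have h := FL.bijective_lift_basis (V := ⨁ i, V i) (DFinsupp.basis b)
  simp only [dfinsupp_basis_apply b] at h
  exact h

/-- In terms of bases, `β̃_u` is the map given by the standard bracketing of words. -/
theorem betaTilde_sourceMap {m : Fin k → ℕ} (u : LyndonWord m)
    (z : FL (ColouredWord (Sigma.fst : (Σ i, X i) → Fin k) u.word)) :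
    (betaTilde V u).toAddMonoidHom (sourceMap b u z) =
      targetMap b (colouredLift Sigma.fst u.word z) := by
  have hβ : IsLieHom (betaTilde V u).toAddMonoidHom := (betaTilde V u).map_lie'
  have ht : IsLieHom (targetMap b) := FL.isLieHom_lift _
  refine FL.hom_ext (F := (betaTilde V u).toAddMonoidHom.comp (sourceMap b u))
    (G := (targetMap b).comp (colouredLift Sigma.fst u.word)) (hβ.comp (FL.isLieHom_lift _))
    (ht.comp (FL.isLieHom_lift _)) (fun x => ?_) z
  obtain ⟨f, rfl⟩ := u.fill.surjective x
  rw [AddMonoidHom.comp_apply, AddMonoidHom.comp_apply, sourceMap, FL.lift_gen, colouredLift,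
    FL.lift_gen, betaTilde, FreeLie.lift_of, mixedBasis, Module.Basis.reindex_apply,
    Equiv.symm_apply_apply, Basis.piTensorProduct_apply]
  have hx : (u.fill f : List (Σ i, X i)) ≠ [] := by
    rw [u.coe_fill]; simpa using u.labels_ne_nil
  rw [stdElement, dif_neg hx, ht.map_evalMonomial]
  have h1 : beta V u (⨂ₜ[ℤ] p, b p.1 (f p)) = betaMultilinear V u fun p => b p.1 (f p) :=
    PiTensorProduct.lift.tprod _
  rw [h1]
  refine Eq.trans ?_ (evalMonomial_stdMonomial_map Sigma.fst
    (fun p : Σ i, Fin (m i) => (⟨p.1, f p⟩ : Σ i, X i)) _ u.labels u.labels_ne_nil hx).symm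
  refine congrArg (fun v => evalMonomial v u.resolution) (funext fun p => ?_)
  rw [targetMap, FL.lift_gen]

theorem sumBetaTilde_of [hdec : DecidableEq (Σ m : Fin k → ℕ, LyndonWord m)]
    (u : Σ m : Fin k → ℕ, LyndonWord m) (x : FreeLie (MixedTensorPower V u.1)) :
    sumBetaTilde V (DirectSum.of (fun u : Σ m : Fin k → ℕ, LyndonWord m =>
      FreeLie (MixedTensorPower V u.1)) u x) = (betaTilde V u.2).toAddMonoidHom x := by
  obtain rfl : hdec = Classical.decEq _ := Subsingleton.elim _ _
  exact @DirectSum.toAddMonoid_of _ _ _ (Classical.decEq _) _ _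
    (fun u : Σ m : Fin k → ℕ, LyndonWord m => (betaTilde V u.2).toAddMonoidHom) u x

end Transfer

section Bijective

variable {k : ℕ} {V : Fin k → Type*} [∀ i, AddCommGroup (V i)] {X : Fin k → Type*}

theorem injective_sumBetaTilde (b : ∀ i, Module.Basis (X i) ℤ (V i)) :
    Function.Injective (sumBetaTilde V) := by
  classical
  rw [injective_iff_map_eq_zero]
  intro d hd
  choose a ha using fun u : Σ m : Fin k → ℕ, LyndonWord m => (bijective_sourceMap b u.2).2 (d u)
  let a' : ∀ w : List (Fin k), FL (ColouredWord (Sigma.fst : (Σ i, X i) → Fin k) w) := fun w =>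
    if h : IsLyndon w then a (lyndonIndex w h) else 0
  have ha' : ∀ u : Σ m : Fin k → ℕ, LyndonWord m, a' u.2.word = a u := by
    rintro ⟨m, w, h, hm⟩
    obtain rfl : (fun i => w.count i) = m := funext hm
    exact dif_pos h
  have hsum : targetMap b (∑ w ∈ d.support.image fun u => u.2.word,
      colouredLift Sigma.fst w (a' w)) = 0 := by
    rw [Finset.sum_image fun u _ v _ h => word_injective h, map_sum, ← hd]
    conv_rhs => rw [← DirectSum.sum_support_of d, map_sum]
    refine Finset.sum_congr rfl fun u _ => ?_
    rw [sumBetaTilde_of, ← ha u, betaTilde_sourceMap, ha' u]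
  rw [map_eq_zero_iff _ (bijective_targetMap b).1] at hsum
  have hzero := eq_zero_of_sum_colouredLift_eq_zero Sigma.fst _ (by
    intro w hw
    obtain ⟨u, -, rfl⟩ := Finset.mem_image.mp hw
    exact u.2.isLyndon) a' hsum
  ext u : 1
  by_cases hu : u ∈ d.support
  · rw [← ha u, ← ha' u, hzero _ (Finset.mem_image_of_mem _ hu), map_zero]
    rfl
  · exact DFinsupp.notMem_support_iff.mp hu

theorem surjective_sumBetaTilde (b : ∀ i, Module.Basis (X i) ℤ (V i)) :
    Function.Surjective (sumBetaTilde V) := by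
  classical
  intro y
  obtain ⟨x, rfl⟩ := (bijective_targetMap b).2 y
  have hle : ⨆ w : {w : List (Fin k) // IsLyndon w},
      (colouredLift (Sigma.fst : (Σ i, X i) → Fin k) w.1).range ≤
        (sumBetaTilde V).range.comap (targetMap b) := by
    refine iSup_le fun w => ?_
    rintro _ ⟨z, rfl⟩
    exact ⟨_, (sumBetaTilde_of (lyndonIndex w.1 w.2) _).trans
      (betaTilde_sourceMap b (lyndonIndex w.1 w.2).2 z)⟩
  exact hle (mem_iSup_range_colouredLift Sigma.fst x)

end Bijective

end HiltonMilnor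

/-- The algebraic Hilton–Milnor theorem: for free abelian groups `V_1, …, V_k`, the direct sum of the
maps `β̃_u` over all Lyndon words `u ∈ B(m_1, …, m_k)`, `m_1, …, m_k ≥ 0`, is an isomorphism
`⨁ Lie[V_1^{⊗ m_1} ⊗ ⋯ ⊗ V_k^{⊗ m_k}] → Lie[V_1 ⊕ ⋯ ⊕ V_k]` of abelian groups. -/
theorem mainTheorem5 (k : ℕ) (V : Fin k → Type*) [∀ i, AddCommGroup (V i)]
    [∀ i, Module.Free ℤ (V i)] :
    Function.Bijective (HiltonMilnor.sumBetaTilde V) :=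
  ⟨HiltonMilnor.injective_sumBetaTilde fun i => Module.Free.chooseBasis ℤ (V i),
    HiltonMilnor.surjective_sumBetaTilde fun i => Module.Free.chooseBasis ℤ (V i)⟩
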